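/- Let $k$ be a field and let $A=k\oplus A_1\oplus A_2\oplus\cdots$ be a connected graded $k$-algebra with every $A_s$ finite-dimensional; the internal grading is called the Adams grading. Put $\mathfrak m=\bigoplus_{s\ge1}A_s$ and $D_s=(\mathfrak m^2)_s$. Choose graded generators, i.e. complements $Q_s$ with $A_s=Q_s\oplus D_s$ $(s\ge1)$, so that $Q=\bigoplus_s Q_s\cong\mathfrak m/\mathfrak m^2$. Choose linear sections $\xi_s\colon D_s\to\bigoplus_{1\le i\le s-1}Q_i\otimes A_{s-i}$ of the multiplication, and let $\theta\colon\mathfrak m\to\bigoplus_{m\ge1}Q^{\otimes m}$ be the resulting graded embedding splitting the multiplication: $\theta(q)=q$ on $Q$ and $\theta=(\mathrm{id}\otimes\theta)\circ\xi$ on $\mathfrak m^2$. Via $\mathrm{id}\otimes\theta$ regard $$\textstyle\bigoplus_{1\le i\le s-1}Q_i\otimes A_{s-i}\subset\bigl(\bigoplus_{m\ge2}Q^{\otimes m}\bigr)_s .$$ Let $R=\bigoplus_{s\ge2}R_s$ be a minimal graded space of relations of $A$ (a minimal graded subspace generating the kernel of $T(Q)\to A$ as a two-sided ideal) with $R_s\subset\bigoplus_{1\le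 i\le s-1}Q_i\otimes A_{s-i}$. Let $i_s^n\colon R_s\to(Q^{\otimes n})_s$ be the inclusion into $(\bigoplus_{m\ge2}Q^{\otimes m})_s$ followed by the projection to tensor length $n$. Let $B^\#A$ be the graded dual of the bar construction of $A$, i.e. the DG algebra of functionals $f$ on $\bigoplus_n\mathfrak m^{\otimes n}$ ($[a_1|\cdots|a_n]$ having degree $-n$) which are finite sums of bihomogeneous ones, with the product dual to deconcatenation (with Koszul signs) and $\partial f=-(-1)^{\deg f}f\circ d$, where $d[a_1|\cdots|a_n]=\sum_{i=2}^n(-1)^{i-1}[a_1|\cdots|a_{i-1}a_i|\cdots|a_n]$. Its cohomology is $E=\operatorname{Ext}^*_A(k,k)$. A bigraded decomposition $B^\#A=B\oplus H\oplus L$, with $B$ the coboundaries and $B\oplus H$ the cocycles, gives the Merkulov model of $E$: identify $E$ with $H$, let $p$ be the projection to $H$, let $G$ vanish on $H\oplus L$ and be inverse to $\partial\colon L\to B$ on $B$, and put $m_n=p\lambda_n$ for $n\ge2$, where $\lambda_2$ is the product, $G\lambda_1=-\mathrm{id}$ and $\lambda_n=\sum_{q+t=n,\ q,t\ge 1}(-1)^{q+1}\lambda_2(G\lambda_q\otimes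 G\lambda_t)$ (with the Koszul sign rule). Call the decomposition compatible with the choices above if $L^1$ annihilates $Q$, $H^2$ and $L^2$ annihilate $\xi_s(D_s)$, and $L^2_{-s}$ annihilates $R_s$, for all $s$ (where $\xi_s(D_s),R_s\subset Q\otimes\mathfrak m\subset\mathfrak m\otimes\mathfrak m$). Then compatible decompositions exist, and for each of them restriction of functionals gives isomorphisms $E^1_{-s}\cong Q_s^\#$ and $E^2_{-s}\cong R_s^\#$ for all $s$; and for all $n\ge2$ and $s\ge2$ the product $m_n$ maps $((E^1)^{\otimes n})_{-s}$ into $E^2_{-s}$ and is there equal to the dual $$(i_s^n)^\#\colon\ ((E^1)^{\otimes n})_{-s}=\bigl((Q^{\otimes n})_s\bigr)^\#\longrightarrow R_s^\#= E^2_{-s}.$$ Here $(E^1)^{\otimes n}$ is identified with the dual of $Q^{\otimes n}$ by the Koszul sign rule (elements of $E^1$ have degree $1$, elements of $Q$ degree $-1$ in the bar construction): explicitly, for homogeneous $x_1,\dots,x_n\in E^1$ of total Adams degree $-s$ and $r\in R_s$, $$m_n(x_1\otimes\cdots\otimes x_n)(r)=(-1)^{n(n-1)/2}\,(x_1\otimes\cdots\otimes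 x_n)\bigl(i_s^n(r)\bigr),$$ where on the right $(x_1\otimes\cdots\otimes x_n)(q_1\otimes\cdots\otimes q_n)=x_1(q_1)\cdots x_n(q_n)$. -/

import Mathlib

open scoped TensorProduct DirectSum

noncomputable section

namespace ExtAInf

/-! ### The graded dual of the bar construction as a DG algebra

Let `M` be a non-unital algebra over `k` (below: the augmentation ideal).  The bar construction is
`BM = ⨁ M^{⊗ n}`, with `[a₁|…|aₙ] = Sa₁ ⊗ ⋯ ⊗ Saₙ` in cohomological degree `-n`.  A linear functional
on `BM` is the same as a function on words `[a₁, …, aₙ] : List M` that is multilinear on the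
words of each length. -/

section Cochains

/-- Functions on words (no linearity yet). -/
@[ext]
structure WordFun (k M : Type*) where
  toFun : List M → k

variable {k M : Type*} [Field k]

instance : CoeFun (WordFun k M) (fun _ => List M → k) := ⟨WordFun.toFun⟩

/-- `WordFun k M` is the type of functions `List M → k`; its vector space structure is pointwise. -/
def WordFun.equivFun : WordFun k M ≃ (List M → k) where
  toFun := WordFun.toFun
  invFun := WordFun.mk
  left_inv _ := rfl
  right_inv _ := rfl

instance : AddCommGroup (WordFun k M) := WordFun.equivFun.addCommGroup
instance : Module k (WordFun k M) := WordFun.equivFun.module k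

/-- The product dual to the deconcatenation coproduct, with the Koszul sign:
`(f · g)[a₁|…|aₙ] = ∑_{p+q=n} (-1)^{pq} f[a₁|…|aₚ] g[aₚ₊₁|…|aₙ]`
(the sign is `(-1)^{|g| |[a₁|…|aₚ]|}`, and only the component of `g` in degree `q` matters). -/
instance : Mul (WordFun k M) where
  mul f g := ⟨fun w => ∑ p ∈ Finset.range (w.length + 1),
    (-1 : k) ^ (p * (w.length - p)) * (f (w.take p) * g (w.drop p))⟩

instance : One (WordFun k M) where
  one := ⟨fun w => if w = [] then 1 else 0⟩

theorem WordFun.mul_apply (f g : WordFun k M) (w : List M) :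
    (f * g) w = ∑ p ∈ Finset.range (w.length + 1),
      (-1 : k) ^ (p * (w.length - p)) * (f (w.take p) * g (w.drop p)) := rfl

theorem WordFun.one_apply (w : List M) : (1 : WordFun k M) w = if w = [] then 1 else 0 := rfl

theorem WordFun.add_apply (f g : WordFun k M) (w : List M) : (f + g) w = f w + g w := rfl

theorem WordFun.smul_apply (c : k) (f : WordFun k M) (w : List M) : (c • f) w = c * f w := rfl

theorem WordFun.zero_apply (w : List M) : (0 : WordFun k M) w = 0 := rfl

theorem WordFun.one_mul' (f : WordFun k M) : 1 * f = f := by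
  ext w
  rw [WordFun.mul_apply, Finset.sum_eq_single 0]
  · simp [WordFun.one_apply]
  · intro p hp h0
    have hp' : p ≤ w.length := by simpa [Nat.lt_succ_iff] using hp
    have : w.take p ≠ [] := by
      intro h
      have := congrArg List.length h
      simp at this
      rcases this with h | h
      · exact h0 h
      · subst h; simp at hp'; exact h0 hp'
    simp [WordFun.one_apply, this]
  · simp

theorem WordFun.mul_one' (f : WordFun k M) : f * 1 = f := by
  ext w
  rw [WordFun.mul_apply, Finset.sum_eq_single w.length]
  · simp [WordFun.one_apply]
  · intro p hp h0
    have hp' : p ≤ w.length := by simpa [Nat.lt_succ_iff] using hp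
    have : w.drop p ≠ [] := by
      intro h
      have := congrArg List.length h
      simp at this
      omega
    rw [WordFun.one_apply, if_neg this]
    ring
  · simp

theorem WordFun.mul_assoc' (f g h : WordFun k M) : f * g * h = f * (g * h) := by
  ext w
  simp only [WordFun.mul_apply, List.length_take, List.length_drop, Finset.mul_sum,
    Finset.sum_mul]
  rw [Finset.sum_sigma', Finset.sum_sigma']
  refine Finset.sum_bij' (fun x _ => ⟨x.2, x.1 - x.2⟩) (fun x _ => ⟨x.1 + x.2, x.1⟩) ?_ ?_ ?_ ?_ ?_
  · rintro ⟨p, q⟩ hx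
    simp only [Finset.mem_sigma, Finset.mem_range] at hx ⊢
    omega
  · rintro ⟨p, q⟩ hx
    simp only [Finset.mem_sigma, Finset.mem_range] at hx ⊢
    omega
  · rintro ⟨p, q⟩ hx
    simp only [Finset.mem_sigma, Finset.mem_range] at hx
    have : q + (p - q) = p := by omega
    simp [this]
  · rintro ⟨p, q⟩ hx
    simp
  · rintro ⟨p, q⟩ hx
    simp only [Finset.mem_sigma, Finset.mem_range] at hx
    obtain ⟨n, hn⟩ : ∃ n, w.length = p + n := ⟨w.length - p, by omega⟩
    obtain ⟨r, hr⟩ : ∃ r, p = q + r := ⟨p - q, by omega⟩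
    subst hr
    have e1 : min (q + r) w.length = q + r := by omega
    have e2 : w.length - (q + r) = n := by omega
    have e3 : w.length - q = r + n := by omega
    simp only [e1, e2, e3, Nat.add_sub_cancel_left, List.take_take, List.drop_drop,
      List.drop_take]
    rw [Nat.min_eq_left (Nat.le_add_right q r)]
    ring

instance : Ring (WordFun k M) where
  __ := (inferInstance : AddCommGroup (WordFun k M))
  mul_assoc := WordFun.mul_assoc'
  one_mul := WordFun.one_mul'
  mul_one := WordFun.mul_one'
  left_distrib f g h := by
    ext w
    simp only [WordFun.mul_apply, WordFun.add_apply, ← Finset.sum_add_distrib]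
    exact Finset.sum_congr rfl fun _ _ => by ring
  right_distrib f g h := by
    ext w
    simp only [WordFun.mul_apply, WordFun.add_apply, ← Finset.sum_add_distrib]
    exact Finset.sum_congr rfl fun _ _ => by ring
  zero_mul f := by
    ext w
    simp [WordFun.mul_apply, WordFun.zero_apply]
  mul_zero f := by
    ext w
    simp [WordFun.mul_apply, WordFun.zero_apply]

instance : Algebra k (WordFun k M) :=
  Algebra.ofModule
    (fun c f g => by
      ext w
      simp only [WordFun.mul_apply, WordFun.smul_apply, Finset.mul_sum]
      exact Finset.sum_congr rfl fun _ _ => by ring)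
    (fun c f g => by
      ext w
      simp only [WordFun.mul_apply, WordFun.smul_apply, Finset.mul_sum]
      exact Finset.sum_congr rfl fun _ _ => by ring)

/-- `contract j [a₁, …, aₙ]` multiplies the neighbours in (0-based) positions `j` and `j + 1`;
it is only used for `j + 1 < n`. -/
def contract [Mul M] : ℕ → List M → List M
  | _, [] => []
  | _, [a] => [a]
  | 0, a :: b :: w => (a * b) :: w
  | j + 1, a :: b :: w => a :: contract j (b :: w)

/-- The differential `∂ f = -(-1)^{deg f} f ∘ d`, where
`d[a₁|…|aₙ] = ∑_{i=2}^n (-1)^{i-1} [a₁|…|aᵢ₋₁aᵢ|…|aₙ]` is the differential of the bar construction.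
On a word of length `n` only the component of `f` in degree `n - 1` enters, whence the
sign `-(-1)^{n-1} = (-1)^n`; the summation index is `j = i - 2`. -/
def wordDiff [Mul M] : WordFun k M →ₗ[k] WordFun k M where
  toFun f := ⟨fun w => (-1 : k) ^ w.length *
    ∑ j ∈ Finset.range (w.length - 1), (-1 : k) ^ (j + 1) * f (contract j w)⟩
  map_add' f g := by
    ext w
    simp only [WordFun.add_apply, mul_add, Finset.sum_add_distrib]
  map_smul' c f := by
    ext w
    simp only [WordFun.smul_apply, Finset.mul_sum, RingHom.id_apply]
    exact Finset.sum_congr rfl fun _ _ => by ring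

theorem wordDiff_apply [Mul M] (f : WordFun k M) (w : List M) :
    wordDiff f w = (-1 : k) ^ w.length *
      ∑ j ∈ Finset.range (w.length - 1), (-1 : k) ^ (j + 1) * f (contract j w) := rfl

/-- `f ↦ (-1)^{e · deg f} f`. -/
def wordTwist (e : ℕ) : WordFun k M →ₗ[k] WordFun k M where
  toFun f := ⟨fun w => (-1 : k) ^ (e * w.length) * f w⟩
  map_add' f g := by
    ext w
    simp only [WordFun.add_apply, mul_add]
  map_smul' c f := by
    ext w
    simp only [WordFun.smul_apply, RingHom.id_apply]
    ring

theorem wordTwist_apply (e : ℕ) (f : WordFun k M) (w : List M) :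
    wordTwist e f w = (-1 : k) ^ (e * w.length) * f w := rfl

/-- Multilinearity on the words of each length. -/
def WordFun.IsMultilinear [AddCommGroup M] [Module k M] (f : WordFun k M) : Prop :=
  ∀ (u v : List M) (a b : M) (c : k),
    f (u ++ (a + c • b) :: v) = f (u ++ a :: v) + c * f (u ++ b :: v)

end Cochains

/-! ### The bar construction of a connected graded algebra -/

section Bar

variable {k A : Type*} [Field k] [Ring A] [Algebra k A]
variable (𝒜 : ℕ → Submodule k A) [GradedAlgebra 𝒜]

/-- The augmentation ideal `𝔪 = ⨁_{i ≥ 1} Aᵢ`, i.e. the elements with vanishing component in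
degree `0`. -/
def augIdeal : NonUnitalSubalgebra k A where
  carrier := {a | GradedRing.projZeroRingHom 𝒜 a = 0}
  add_mem' {a b} ha hb := by
    simp only [Set.mem_ofPred_eq, map_add] at *
    rw [ha, hb, add_zero]
  zero_mem' := by simp
  mul_mem' {a b} ha hb := by
    simp only [Set.mem_ofPred_eq, map_mul] at *
    rw [ha, zero_mul]
  smul_mem' c a ha := by
    simp only [Set.mem_ofPred_eq] at *
    rw [Algebra.smul_def, map_mul, ha, mul_zero]

/-- `A_s` as a subspace of `𝔪` (it is `0` for `s = 0`). -/
def augPart (s : ℕ) : Submodule k (augIdeal 𝒜) :=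
  (𝒜 s).comap ((augIdeal 𝒜).toSubmodule.subtype)

/-- The decomposables `𝔪²`. -/
def decomposables : Submodule k (augIdeal 𝒜) :=
  Submodule.span k {x | ∃ a b : augIdeal 𝒜, x = a * b}

/-- `D_s = (𝔪²)_s`. -/
def decPart (s : ℕ) : Submodule k (augIdeal 𝒜) := decomposables 𝒜 ⊓ augPart 𝒜 s

/-- `w = [a₁, …, aₙ]` with `aᵢ` homogeneous of some degree `dᵢ` and `d₁ + ⋯ + dₙ = s`. -/
def IsHomWord (w : List (augIdeal 𝒜)) (s : ℕ) : Prop :=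
  ∃ ds : List ℕ, List.Forall₂ (fun (a : augIdeal 𝒜) d => (a : A) ∈ 𝒜 d) w ds ∧ ds.sum = s

/-- The functionals on the bar construction of cohomological degree `n` and Adams degree `-s`,
i.e. the dual of `(𝔪^{⊗ n})_s`: multilinear functions supported on words of length `n`, vanishing
on the homogeneous words of Adams degree different from `s`. -/
def wordPart (n s : ℕ) : Submodule k (WordFun k (augIdeal 𝒜)) where
  carrier := {f | f.IsMultilinear ∧ (∀ w, w.length ≠ n → f w = 0) ∧
    ∀ w t, IsHomWord 𝒜 w t → t ≠ s → f w = 0}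
  add_mem' {f g} hf hg := by
    refine ⟨fun u v a b c => ?_, fun w hw => ?_, fun w t hw ht => ?_⟩
    · simp only [WordFun.add_apply, hf.1 u v a b c, hg.1 u v a b c]
      ring
    · simp [WordFun.add_apply, hf.2.1 w hw, hg.2.1 w hw]
    · simp [WordFun.add_apply, hf.2.2 w t hw ht, hg.2.2 w t hw ht]
  zero_mem' := ⟨fun u v a b c => by simp [WordFun.zero_apply], fun _ _ => WordFun.zero_apply _,
    fun _ _ _ _ => WordFun.zero_apply _⟩
  smul_mem' c f hf := by
    refine ⟨fun u v a b c' => ?_, fun w hw => ?_, fun w t hw ht => ?_⟩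
    · simp only [WordFun.smul_apply, hf.1 u v a b c']
      ring
    · simp [WordFun.smul_apply, hf.2.1 w hw]
    · simp [WordFun.smul_apply, hf.2.2 w t hw ht]

theorem one_mem_wordPart : (1 : WordFun k (augIdeal 𝒜)) ∈ wordPart 𝒜 0 0 := by
  refine ⟨fun u v a b c => ?_, fun w hw => ?_, fun w t hw ht => ?_⟩
  · simp [WordFun.one_apply]
  · rw [WordFun.one_apply, if_neg]
    rintro rfl
    exact hw rfl
  · rw [WordFun.one_apply, if_neg]
    rintro rfl
    obtain ⟨ds, hds, hs⟩ := hw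
    cases hds
    exact ht hs.symm

theorem mul_mem_wordPart {n n' s s' : ℕ} {f g : WordFun k (augIdeal 𝒜)}
    (hf : f ∈ wordPart 𝒜 n s) (hg : g ∈ wordPart 𝒜 n' s') :
    f * g ∈ wordPart 𝒜 (n + n') (s + s') := by
  refine ⟨fun u v a b c => ?_, fun w hw => ?_, fun w t hw ht => ?_⟩
  · simp only [WordFun.mul_apply, List.length_append, List.length_cons, Finset.mul_sum,
      ← Finset.sum_add_distrib]
    refine Finset.sum_congr rfl fun p _ => ?_
    rcases Nat.lt_or_ge u.length p with h | h
    · obtain ⟨r, rfl⟩ : ∃ r, p = u.length + (r + 1) := ⟨p - u.length - 1, by omega⟩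
      simp only [List.take_length_add_append, List.drop_length_add_append, List.take_succ_cons,
        List.drop_succ_cons]
      rw [hf.1]
      ring
    · simp only [List.take_append_of_le_length h, List.drop_append_of_le_length h]
      rw [hg.1]
      ring
  · rw [WordFun.mul_apply]
    refine Finset.sum_eq_zero fun p hp => ?_
    have hp' : p ≤ w.length := by simpa [Nat.lt_succ_iff] using hp
    by_cases h1 : p = n
    · rw [hg.2.1 (w.drop p) (by rw [List.length_drop]; omega)]
      ring
    · rw [hf.2.1 (w.take p) (by rw [List.length_take]; omega)]
      ring
  · rw [WordFun.mul_apply]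
    refine Finset.sum_eq_zero fun p hp => ?_
    obtain ⟨ds, hds, hs⟩ := hw
    have h1 : IsHomWord 𝒜 (w.take p) (ds.take p).sum := ⟨_, List.forall₂_take p hds, rfl⟩
    have h2 : IsHomWord 𝒜 (w.drop p) (ds.drop p).sum := ⟨_, List.forall₂_drop p hds, rfl⟩
    have h3 : (ds.take p).sum + (ds.drop p).sum = t := by rw [List.sum_take_add_sum_drop, hs]
    by_cases h : (ds.take p).sum = s
    · rw [hg.2.2 _ _ h2 (by omega)]
      ring
    · rw [hf.2.2 _ _ h1 h]
      ring

/-- The graded dual `B^# A` of the bar construction, as an algebra: finite sums of bihomogeneous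
functionals. -/
def barDual : Subalgebra k (WordFun k (augIdeal 𝒜)) where
  carrier := ((⨆ (n : ℕ) (s : ℕ), wordPart 𝒜 n s : Submodule k _) : Set _)
  add_mem' := Submodule.add_mem _
  algebraMap_mem' c := by
    rw [Algebra.algebraMap_eq_smul_one]
    exact Submodule.smul_mem _ _
      (Submodule.mem_iSup_of_mem 0 (Submodule.mem_iSup_of_mem 0 (one_mem_wordPart 𝒜)))
  mul_mem' {f g} hf hg := by
    simp only [SetLike.mem_coe] at hf hg ⊢
    have key : (⨆ (n : ℕ) (s : ℕ), wordPart 𝒜 n s) * (⨆ (n : ℕ) (s : ℕ), wordPart 𝒜 n s)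
        ≤ ⨆ (n : ℕ) (s : ℕ), wordPart 𝒜 n s := by
      simp only [Submodule.iSup_mul, Submodule.mul_iSup, iSup_le_iff]
      intro n s n' s'
      rw [Submodule.mul_le]
      intro x hx y hy
      exact Submodule.mem_iSup_of_mem _ (Submodule.mem_iSup_of_mem _ (mul_mem_wordPart 𝒜 hx hy))
    exact key (Submodule.mul_mem_mul hf hg)

theorem IsMultilinear_contract {f : WordFun k (augIdeal 𝒜)} (j : ℕ) (hf : f.IsMultilinear) :
    WordFun.IsMultilinear (k := k) (M := augIdeal 𝒜) ⟨fun w => f (contract j w)⟩ := by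
  induction j generalizing f with
  | zero =>
    intro u v a b c
    match u, v with
    | [], [] => exact hf [] [] a b c
    | [], y :: v =>
      have := hf [] v (a * y) (b * y) c
      simpa [contract, add_mul, smul_mul_assoc] using this
    | [y], v =>
      have := hf [] v (y * a) (y * b) c
      simpa [contract, mul_add, mul_smul_comm] using this
    | y :: z :: u, v => exact hf ((y * z) :: u) v a b c
  | succ j ih =>
    intro u v a b c
    match u, v with
    | [], [] => exact hf [] [] a b c
    | [], y :: v => exact hf [] (contract j (y :: v)) a b c
    | [y], v =>
      exact ih (f := ⟨fun w => f (y :: w)⟩) (fun u v a b c => hf (y :: u) v a b c) [] v a b c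
    | y :: z :: u, v =>
      exact ih (f := ⟨fun w => f (y :: w)⟩) (fun u v a b c => hf (y :: u) v a b c) (z :: u) v a b c

theorem length_contract {M : Type*} [Mul M] (j : ℕ) (w : List M) (h : j + 1 < w.length) :
    (contract j w).length + 1 = w.length := by
  induction j generalizing w with
  | zero =>
    match w with
    | a :: b :: w => rfl
  | succ j ih =>
    match w with
    | a :: b :: w =>
      have := ih (b :: w) (by simpa using h)
      simpa [contract] using this

theorem IsHomWord_contract (j : ℕ) {w : List (augIdeal 𝒜)} {t : ℕ} (h : IsHomWord 𝒜 w t) :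
    IsHomWord 𝒜 (contract j w) t := by
  obtain ⟨ds, hds, hs⟩ := h
  induction j generalizing w ds t with
  | zero =>
    match w, ds, hds with
    | [], [], _ => exact ⟨[], .nil, hs⟩
    | [a], [d], h => exact ⟨[d], h, hs⟩
    | a :: b :: w, d :: e :: ds, .cons ha (.cons hb h) =>
      refine ⟨(d + e) :: ds, .cons (SetLike.mul_mem_graded ha hb) h, ?_⟩
      rw [← hs]
      simp [add_assoc]
  | succ j ih =>
    match w, ds, hds with
    | [], [], _ => exact ⟨[], .nil, hs⟩
    | [a], [d], h => exact ⟨[d], h, hs⟩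
    | a :: b :: w, d :: e :: ds, .cons ha h =>
      obtain ⟨ds', h1, h2⟩ := ih (e :: ds) h rfl
      refine ⟨d :: ds', .cons ha h1, ?_⟩
      rw [← hs, List.sum_cons, h2, List.sum_cons, List.sum_cons, List.sum_cons]

theorem wordDiff_mem {n s : ℕ} {f : WordFun k (augIdeal 𝒜)} (hf : f ∈ wordPart 𝒜 n s) :
    wordDiff f ∈ wordPart 𝒜 (n + 1) s := by
  refine ⟨fun u v a b c => ?_, fun w hw => ?_, fun w t hw ht => ?_⟩
  · have e : ∀ x : augIdeal 𝒜, (u ++ x :: v).length = u.length + v.length + 1 := fun x => by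
      simp
      omega
    simp only [wordDiff_apply, e, Finset.mul_sum,
      ← Finset.sum_add_distrib]
    refine Finset.sum_congr rfl fun j _ => ?_
    rw [show f (contract j (u ++ (a + c • b) :: v)) = _ from
      IsMultilinear_contract 𝒜 j hf.1 u v a b c]
    ring
  · rw [wordDiff_apply]
    rw [Finset.sum_eq_zero, mul_zero]
    intro j hj
    have hj' : j + 1 < w.length := by
      have := Finset.mem_range.mp hj
      omega
    rw [hf.2.1, mul_zero]
    have := length_contract j w hj'
    omega
  · rw [wordDiff_apply]
    rw [Finset.sum_eq_zero, mul_zero]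
    intro j _
    rw [hf.2.2 _ t (IsHomWord_contract 𝒜 j hw) ht, mul_zero]

theorem wordTwist_mem (e : ℕ) {n s : ℕ} {f : WordFun k (augIdeal 𝒜)} (hf : f ∈ wordPart 𝒜 n s) :
    wordTwist e f ∈ wordPart 𝒜 n s := by
  refine ⟨fun u v a b c => ?_, fun w hw => ?_, fun w t hw ht => ?_⟩
  · simp only [wordTwist_apply, hf.1 u v a b c, List.length_append,
      List.length_cons]
    ring
  · simp [wordTwist_apply, hf.2.1 w hw]
  · simp [wordTwist_apply, hf.2.2 w t hw ht]

theorem barDual_stable {φ : WordFun k (augIdeal 𝒜) →ₗ[k] WordFun k (augIdeal 𝒜)}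
    (hφ : ∀ n s, ∀ f ∈ wordPart 𝒜 n s, φ f ∈ barDual 𝒜) (f : WordFun k (augIdeal 𝒜))
    (hf : f ∈ barDual 𝒜) : φ f ∈ barDual 𝒜 := by
  have h : (⨆ (n : ℕ) (s : ℕ), wordPart 𝒜 n s) ≤ (Subalgebra.toSubmodule (barDual 𝒜)).comap φ := by
    simp only [iSup_le_iff]
    exact fun n s f hf => hφ n s f hf
  exact h hf

theorem wordPart_le_barDual {n s : ℕ} {f : WordFun k (augIdeal 𝒜)} (hf : f ∈ wordPart 𝒜 n s) :
    f ∈ barDual 𝒜 :=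
  Submodule.mem_iSup_of_mem n (Submodule.mem_iSup_of_mem (p := fun s => wordPart 𝒜 n s) s hf)

/-- The differential of the DG algebra `B^# A`. -/
def barDiff : barDual 𝒜 →ₗ[k] barDual 𝒜 :=
  LinearMap.restrict (p := Subalgebra.toSubmodule (barDual 𝒜))
    (q := Subalgebra.toSubmodule (barDual 𝒜)) wordDiff
    (barDual_stable 𝒜 fun _ _ _ hf => wordPart_le_barDual 𝒜 (wordDiff_mem 𝒜 hf))

/-- `f ↦ (-1)^{e · deg f} f` on `B^# A`. -/
def barTwist (e : ℕ) : barDual 𝒜 →ₗ[k] barDual 𝒜 :=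
  LinearMap.restrict (p := Subalgebra.toSubmodule (barDual 𝒜))
    (q := Subalgebra.toSubmodule (barDual 𝒜)) (wordTwist e)
    (barDual_stable 𝒜 fun _ _ _ hf => wordPart_le_barDual 𝒜 (wordTwist_mem 𝒜 e hf))

/-- The component of `B^# A` of cohomological degree `n` and Adams degree `-s`. -/
def barPart (n s : ℕ) : Submodule k (barDual 𝒜) :=
  (wordPart 𝒜 n s).comap (Subalgebra.toSubmodule (barDual 𝒜)).subtype

theorem barDual_isMultilinear (f : barDual 𝒜) : (f : WordFun k (augIdeal 𝒜)).IsMultilinear := by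
  intro u v a b c
  let ev (w : List (augIdeal 𝒜)) : WordFun k (augIdeal 𝒜) →ₗ[k] k :=
    { toFun := fun g => g w, map_add' := fun _ _ => rfl, map_smul' := fun _ _ => rfl }
  have h : (⨆ (n : ℕ) (s : ℕ), wordPart 𝒜 n s) ≤
      LinearMap.ker (ev (u ++ (a + c • b) :: v) - ev (u ++ a :: v) - c • ev (u ++ b :: v)) := by
    simp only [iSup_le_iff]
    intro n s g hg
    have := hg.1 u v a b c
    simp only [LinearMap.mem_ker, LinearMap.sub_apply, LinearMap.smul_apply, smul_eq_mul]
    change g _ - g _ - c * g _ = 0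
    rw [this]
    ring
  have h2 : (f : WordFun k (augIdeal 𝒜)) (u ++ (a + c • b) :: v) -
      (f : WordFun k (augIdeal 𝒜)) (u ++ a :: v) -
      c * (f : WordFun k (augIdeal 𝒜)) (u ++ b :: v) = 0 := h f.2
  linear_combination h2

theorem barDual_zero (f : barDual 𝒜) (u v : List (augIdeal 𝒜)) :
    (f : WordFun k (augIdeal 𝒜)) (u ++ 0 :: v) = 0 := by
  have := barDual_isMultilinear 𝒜 f u v 0 0 1
  simpa using this

theorem barDual_add (f : barDual 𝒜) (u v : List (augIdeal 𝒜)) (a b : augIdeal 𝒜) :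
    (f : WordFun k (augIdeal 𝒜)) (u ++ (a + b) :: v) =
      (f : WordFun k (augIdeal 𝒜)) (u ++ a :: v) + (f : WordFun k (augIdeal 𝒜)) (u ++ b :: v) := by
  have := barDual_isMultilinear 𝒜 f u v a b 1
  simpa using this

theorem barDual_smul (f : barDual 𝒜) (u v : List (augIdeal 𝒜)) (c : k) (a : augIdeal 𝒜) :
    (f : WordFun k (augIdeal 𝒜)) (u ++ (c • a) :: v) =
      c * (f : WordFun k (augIdeal 𝒜)) (u ++ a :: v) := by
  have := barDual_isMultilinear 𝒜 f u v 0 a c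
  simpa [barDual_zero] using this

variable {𝒜}

/-- The functional `a ↦ f[a]` on `𝔪`. -/
def evalOne (f : barDual 𝒜) : augIdeal 𝒜 →ₗ[k] k where
  toFun a := (f : WordFun k (augIdeal 𝒜)) [a]
  map_add' a b := barDual_add 𝒜 f [] [] a b
  map_smul' c a := barDual_smul 𝒜 f [] [] c a

/-- The functional `a ⊗ b ↦ f[a|b]` on `𝔪 ⊗ 𝔪`. -/
def evalTwo (f : barDual 𝒜) : (augIdeal 𝒜 ⊗[k] augIdeal 𝒜) →ₗ[k] k :=
  TensorProduct.lift (LinearMap.mk₂ k (fun a b => (f : WordFun k (augIdeal 𝒜)) [a, b])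
    (fun a a' b => barDual_add 𝒜 f [] [b] a a') (fun c a b => barDual_smul 𝒜 f [] [b] c a)
    (fun a b b' => barDual_add 𝒜 f [a] [] b b') (fun c a b => barDual_smul 𝒜 f [a] [] c b))

end Bar

/-! ### Merkulov's construction for a bigraded DG algebra -/

section Merkulov

variable {k T : Type*} [Field k] [Ring T] [Algebra k T]

/-- The choices in Merkulov's construction for a DG algebra `(T, ∂)` with `T = ⨁ T^n_{-s}` and
`T^n_{-s} = 𝒯 n s`.  Here `B^n_{-s} = 𝒯 n s ⊓ range ∂` are the coboundaries and
`Z^n_{-s} = 𝒯 n s ⊓ ker ∂` the cocycles.  The subspaces `H`, `L` satisfy `Z = B ⊕ H` and `T = Z ⊕ L`,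
bidegree by bidegree; they determine the projection `p` onto `H` and the homotopy `G`, which
vanishes on `H` and `L` and inverts `∂ : L → B` on `B`.  Cohomology is identified with `H`. -/
structure MerkulovData (𝒯 : ℕ → ℕ → Submodule k T) (d : T →ₗ[k] T) where
  H : ℕ → ℕ → Submodule k T
  L : ℕ → ℕ → Submodule k T
  disjoint_B_H : ∀ n s, Disjoint (𝒯 n s ⊓ LinearMap.range d) (H n s)
  B_sup_H : ∀ n s, (𝒯 n s ⊓ LinearMap.range d) ⊔ H n s = 𝒯 n s ⊓ LinearMap.ker d
  disjoint_Z_L : ∀ n s, Disjoint (𝒯 n s ⊓ LinearMap.ker d) (L n s)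
  Z_sup_L : ∀ n s, (𝒯 n s ⊓ LinearMap.ker d) ⊔ L n s = 𝒯 n s
  p : T →ₗ[k] T
  p_H : ∀ n s, ∀ x ∈ H n s, p x = x
  p_L : ∀ n s, ∀ x ∈ L n s, p x = 0
  p_B : ∀ x, p (d x) = 0
  G : T →ₗ[k] T
  G_H : ∀ n s, ∀ x ∈ H n s, G x = 0
  G_L : ∀ n s, ∀ x ∈ L n s, G x = 0
  G_B : ∀ n s, ∀ x ∈ L n s, G (d x) = x

/-- The maps `Gλₙ`, evaluated on `[a₁, …, aₙ]`: `Gλ₁ = -id` by convention, and for `n ≥ 2` one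
applies `G` to `λₙ = ∑_{q+t=n} (-1)^{q+1} λ₂ (Gλ_q ⊗ Gλ_t)`.  By the Koszul rule,
`(Gλ_q ⊗ Gλ_t)(a₁ ⊗ ⋯ ⊗ aₙ)` carries the sign `(-1)^{(1-t)(|a₁| + ⋯ + |a_q|)}`, since `Gλ_t` has degree
`1 - t`; `tw e` is the map `a ↦ (-1)^{e |a|} a`.  The summation index is `j = q - 1`. -/
def Glam (tw : ℕ → T →ₗ[k] T) (G : T →ₗ[k] T) : List T → T
  | [] => 0
  | [a] => -a
  | a :: b :: w => G (∑ j : Fin (w.length + 1), (-1 : T) ^ (j : ℕ) *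
      (Glam tw G (((a :: b :: w).take (j + 1)).map (tw (w.length - j))) *
        Glam tw G ((a :: b :: w).drop (j + 1))))
  termination_by w => w.length
  decreasing_by
  · have := j.2
    simp
    omega
  · simp

/-- The maps `λₙ` for `n ≥ 2`, evaluated on `[a₁, …, aₙ]`:
`λₙ = ∑_{q+t=n, q,t≥1} (-1)^{q+1} λ₂ (Gλ_q ⊗ Gλ_t)`.  For `n = 2` this is the product of `T`. -/
def lam (tw : ℕ → T →ₗ[k] T) (G : T →ₗ[k] T) (w : List T) : T :=
  ∑ q ∈ Finset.Ico 1 w.length, (-1 : T) ^ (q + 1) *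
    (Glam tw G ((w.take q).map (tw (w.length - q - 1))) * Glam tw G (w.drop q))

theorem Glam_eq (tw : ℕ → T →ₗ[k] T) (G : T →ₗ[k] T) (w : List T) (hw : 2 ≤ w.length) :
    Glam tw G w = G (lam tw G w) := by
  match w with
  | a :: b :: w =>
    rw [Glam, lam, Finset.sum_Ico_eq_sum_range]
    simp only [List.length_cons, Nat.add_sub_cancel]
    rw [← Fin.sum_univ_eq_sum_range (fun q => (-1 : T) ^ (1 + q + 1) *
      (Glam tw G (((a :: b :: w).take (1 + q)).map (tw (w.length + 1 + 1 - (1 + q) - 1))) *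
        Glam tw G ((a :: b :: w).drop (1 + q)))) (w.length + 1)]
    congr 1
    refine Finset.sum_congr rfl fun j _ => ?_
    have e1 : w.length + 1 + 1 - (1 + (j : ℕ)) - 1 = w.length - j := by omega
    have e2 : (-1 : T) ^ (1 + (j : ℕ) + 1) = (-1) ^ (j : ℕ) := by
      rw [pow_succ, pow_add]
      simp
    rw [e1, e2, add_comm 1 (j : ℕ)]

theorem lam_two (tw : ℕ → T →ₗ[k] T) (htw : ∀ x, tw 0 x = x) (G : T →ₗ[k] T) (a b : T) :
    lam tw G [a, b] = a * b := by
  simp [lam, Glam, htw]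

end Merkulov

/-! ### Generators, relations, and Ext -/

section Relations

variable {k A : Type*} [Field k] [Ring A] [Algebra k A]
variable (𝒜 : ℕ → Submodule k A) [GradedAlgebra 𝒜]

/-- A choice of graded generators: `A_s = Q_s ⊕ D_s` for all `s ≥ 1`, with `D_s = (𝔪²)_s`; so
`Q = ⨁ Q_s` maps isomorphically onto `𝔪 / 𝔪²`. -/
structure Generators where
  Q : ℕ → Submodule k (augIdeal 𝒜)
  Q_sup_D : ∀ s, Q s ⊔ decPart 𝒜 s = augPart 𝒜 s
  disjoint_Q_D : ∀ s, Disjoint (Q s) (decPart 𝒜 s)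

namespace Generators

variable {𝒜} (g : Generators 𝒜)

/-- `Q = ⨁ Q_s` as a subspace of `𝔪`. -/
def tot : Submodule k (augIdeal 𝒜) := ⨆ s, g.Q s

/-- `⨁_{1 ≤ i ≤ s-1} Q_i ⊗ A_{s-i}` as a subspace of `Q ⊗ 𝔪`. -/
def QAPart (s : ℕ) : Submodule k (g.tot ⊗[k] augIdeal 𝒜) :=
  Submodule.span k {z | ∃ i j : ℕ, i + j = s ∧ ∃ q : g.tot, (q : augIdeal 𝒜) ∈ g.Q i ∧
    ∃ a ∈ augPart 𝒜 j, z = q ⊗ₜ[k] a}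

/-- The inclusion `Q ⊗ 𝔪 ⊂ 𝔪 ⊗ 𝔪`. -/
def QAIncl : (g.tot ⊗[k] augIdeal 𝒜) →ₗ[k] (augIdeal 𝒜 ⊗[k] augIdeal 𝒜) :=
  LinearMap.rTensor (augIdeal 𝒜) g.tot.subtype

/-- The multiplication `Q ⊗ 𝔪 → 𝔪`. -/
def QAMul : (g.tot ⊗[k] augIdeal 𝒜) →ₗ[k] augIdeal 𝒜 :=
  LinearMap.mul' k (augIdeal 𝒜) ∘ₗ g.QAIncl

/-- The multiplication `T(Q) → A` of the tensor algebra. -/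
def freeMul : TensorAlgebra k g.tot →ₐ[k] A :=
  TensorAlgebra.lift k ((augIdeal 𝒜).toSubmodule.subtype ∘ₗ g.tot.subtype)

/-- For a linear map `θ : 𝔪 → T(Q)`, the map `Q ⊗ 𝔪 → T(Q)`, `q ⊗ a ↦ q · θ(a)`. -/
def extend (θ : augIdeal 𝒜 →ₗ[k] TensorAlgebra k g.tot) :
    (g.tot ⊗[k] augIdeal 𝒜) →ₗ[k] TensorAlgebra k g.tot :=
  LinearMap.mul' k (TensorAlgebra k g.tot) ∘ₗ TensorProduct.map (TensorAlgebra.ι k) θ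

/-- A choice of an embedding `θ` of `𝔪` into the tensor algebra of `Q` that splits the
multiplication.  One chooses degree-preserving linear sections
`ξ_s : D_s → ⨁_{1 ≤ i ≤ s-1} Q_i ⊗ A_{s-i}` of the multiplication; these determine `θ` recursively by
`θ(q) = q` on `Q` and `θ = (id ⊗ θ) ∘ ξ` on `D`. -/
structure Embedding where
  ξ : decomposables 𝒜 →ₗ[k] (g.tot ⊗[k] augIdeal 𝒜)
  ξ_mem : ∀ (s : ℕ) (x : decomposables 𝒜), (x : augIdeal 𝒜) ∈ augPart 𝒜 s → ξ x ∈ g.QAPart s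
  mul_ξ : ∀ x : decomposables 𝒜, g.QAMul (ξ x) = x
  θ : augIdeal 𝒜 →ₗ[k] TensorAlgebra k g.tot
  θ_gen : ∀ q : g.tot, θ q = TensorAlgebra.ι k q
  θ_dec : ∀ x : decomposables 𝒜, θ x = g.extend θ (ξ x)

variable {g} (e : g.Embedding)

/-- The embedding `Q ⊗ 𝔪 → T(Q)`, `q ⊗ a ↦ q · θ(a)`, with image in `⨁_{m ≥ 2} Q^{⊗ m}`. -/
def Embedding.incl : (g.tot ⊗[k] augIdeal 𝒜) →ₗ[k] TensorAlgebra k g.tot := g.extend e.θ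

/-- `Q ⊗ 𝔪 → T(Q) → Q^{⊗ n}`: the embedding followed by the projection to tensor length `n`.
Its restriction to `R_s` is `i_s^n`. -/
def Embedding.inclProj (n : ℕ) : (g.tot ⊗[k] augIdeal 𝒜) →ₗ[k] ⨂[k]^n g.tot :=
  DirectSum.component k ℕ (fun n => ⨂[k]^n g.tot) n ∘ₗ
    TensorAlgebra.toDirectSum.toLinearMap ∘ₗ e.incl

/-- `R = ⨁ R_s` with `R_s ⊂ ⨁_{1 ≤ i ≤ s-1} Q_i ⊗ A_{s-i} ⊂ (⨁_{m ≥ 2} Q^{⊗ m})_s` is a minimal graded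
space of relations of `A`: it generates the kernel of `T(Q) → A` as a two-sided ideal, and no
smaller graded subspace does. -/
structure Embedding.IsMinimalRelations
    (R : ℕ → Submodule k (g.tot ⊗[k] augIdeal 𝒜)) : Prop where
  le : ∀ s, R s ≤ g.QAPart s
  generates : TwoSidedIdeal.span (⋃ s, e.incl '' (R s : Set (g.tot ⊗[k] augIdeal 𝒜))) =
    TwoSidedIdeal.ker g.freeMul
  minimal : ∀ R' : ℕ → Submodule k (g.tot ⊗[k] augIdeal 𝒜), (∀ s, R' s ≤ R s) →
    TwoSidedIdeal.span (⋃ s, e.incl '' (R' s : Set (g.tot ⊗[k] augIdeal 𝒜))) =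
      TwoSidedIdeal.ker g.freeMul → R' = R

end Generators

/-- The pairing of `φ₁ ⊗ ⋯ ⊗ φₙ ∈ (Q^#)^{⊗ n}` with `Q^{⊗ n}`, where all `φᵢ` have degree `1` and the
elements of `Q`, as elements `[q]` of the bar construction, have degree `-1`.  The Koszul sign is
`(-1)^{n(n-1)/2}`:
`⟨φ₁ ⊗ ⋯ ⊗ φₙ, q₁ ⊗ ⋯ ⊗ qₙ⟩ = (-1)^{n(n-1)/2} φ₁(q₁) ⋯ φₙ(qₙ)`. -/
def koszulPairing {V : Type*} [AddCommGroup V] [Module k V] {n : ℕ} (φ : Fin n → Module.Dual k V) :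
    (⨂[k]^n V) →ₗ[k] k :=
  (-1 : k) ^ (n * (n - 1) / 2) •
    PiTensorProduct.lift ((MultilinearMap.mkPiAlgebra k (Fin n) k).compLinearMap φ)

theorem koszulPairing_tprod {V : Type*} [AddCommGroup V] [Module k V] {n : ℕ}
    (φ : Fin n → Module.Dual k V) (q : Fin n → V) :
    koszulPairing φ (PiTensorProduct.tprod k q) = (-1 : k) ^ (n * (n - 1) / 2) * ∏ i, φ i (q i) := by
  simp [koszulPairing]

/-- Merkulov data for the DG algebra `B^# A`.  The cohomology of `B^# A` is `E = Ext_A(k, k)`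
(the complex `Hom_A(B(A, A), k)` of the bar resolution), so `H n s` is `E^n_{-s}`. -/
abbrev ExtModel : Type _ := MerkulovData (barPart 𝒜) (barDiff 𝒜)

variable {𝒜}

/-- The multiplication `mₙ = p λₙ` of the Merkulov model, for `n ≥ 2`, evaluated on
`x₁ ⊗ ⋯ ⊗ xₙ`. -/
def ExtModel.mul (M : ExtModel 𝒜) {n : ℕ} (x : Fin n → barDual 𝒜) : barDual 𝒜 :=
  M.p (lam (barTwist 𝒜) M.G (List.ofFn x))

/-- The decomposition `B^# A = B ⊕ H ⊕ L` is the one dual to `𝔪 = Q ⊕ D` and to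
`𝔪 ⊗ 𝔪 = im d ⊕ R ⊕ ξ(D)`: in cohomological degree `1`, `L` is the annihilator of `Q`; in
cohomological degree `2`, `H` annihilates `ξ(D)` and `L` annihilates `R` and `ξ(D)`. -/
structure ExtModel.IsCompatible (M : ExtModel 𝒜) {g : Generators 𝒜} (e : g.Embedding)
    (R : ℕ → Submodule k (g.tot ⊗[k] augIdeal 𝒜)) : Prop where
  L_one : ∀ s, ∀ f ∈ M.L 1 s, ∀ q : g.tot, evalOne f q = 0
  H_two : ∀ s, ∀ f ∈ M.H 2 s, ∀ x : decomposables 𝒜, evalTwo f (g.QAIncl (e.ξ x)) = 0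
  L_two : ∀ s, ∀ f ∈ M.L 2 s, ∀ x : decomposables 𝒜, evalTwo f (g.QAIncl (e.ξ x)) = 0
  L_two_R : ∀ s, ∀ f ∈ M.L 2 s, ∀ r ∈ R s, evalTwo f (g.QAIncl r) = 0

end Relations

end ExtAInf

end

/-!
The cochains of `B^# A` in degrees `1` and `2` are functionals on `𝔪` and `𝔪 ⊗ 𝔪`, and the proof
rests on the decompositions `𝔪 = Q ⊕ D` and `𝔪 ⊗ 𝔪 = im d ⊕ R ⊕ ξ(D)`, where `im d` is spanned by the
elements `ab ⊗ c - a ⊗ bc`.  A compatible decomposition of `B^# A` is the dual of these two.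

Write `F = T(Q)`, `F₊` for its augmentation ideal, `π : F → A` for the multiplication with kernel
`I`, and `K = F₊ I + I F₊`.  The second decomposition is used in dual form.

* A `2`-cocycle `f` vanishing on `R` and `ξ(D)` is zero
  (`Generators.Embedding.IsMinimalRelations.evalTwo_eq_zero`).  Pulled back to `F`, the cocycle
  becomes the coboundary of the functional `Ψ` with `Ψ(1) = 0` and `Ψ(q y) = f(q, π(y)₊)` for `q ∈ Q`,
  where `₊` denotes the component in `𝔪`.  Hence `Ψ` vanishes on the ideal `I` as soon as it
  vanishes on its generators `R`.  Evaluating it at `θ(a) θ(b) - θ(ab) ∈ I` gives `f(a, b) = 0`.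
* Every functional on `R_s` extends to a `2`-cocycle vanishing on `ξ(D)`
  (`Generators.Embedding.IsMinimalRelations.exists_cocycle`).  By minimality and the graded
  Nakayama lemma, `R_s` meets `K` in `0`, so the functional is the restriction of one, `χ`, on `F`
  that vanishes on `K`.  Then `f(a, b) = χ(θ(a) θ(b) - θ(ab))` is a cocycle: its coboundary is `χ`
  evaluated on elements of `K`.

For a compatible decomposition, the homotopy in degree `2` is therefore explicit: `G y` vanishes on
`Q` and equals `-y ∘ ξ` on `D` (`ExtModel.IsCompatible.G_two`).  On `q ⊗ b` with `q ∈ Q` only the summand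
`Gλ₁ ⊗ Gλₙ₋₁` of `λₙ` survives, which gives `λₙ(x₁, …, xₙ)(q ⊗ b) = ± x₁(q) · Gλₙ₋₁(x₂, …, xₙ)(b)`.  This
is the recursion `θ = (id ⊗ θ) ∘ ξ`, so by induction `Gλₙ(x₁, …, xₙ)` is, up to sign,
`(x₁ ⊗ ⋯ ⊗ xₙ) ∘ θ` (`ExtModel.IsCompatible.evalOne_Glam`), and `λₙ` restricted to `R` is the dual of the
inclusion of `R` into `F`.  The projection `p` does not change restrictions to `R`.
-/

noncomputable section

namespace ExtAInf

/-! ### Linear algebra over a field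

The modules here and the generating space `V` of the tensor algebra below carry only an additive
monoid structure, which is the one found on subspaces of `𝔪` and their tensor products; over a
field, negation is multiplication by `-1`. -/

section LinearAlgebra

variable {k E F : Type*} [Field k] [AddCommMonoid E] [Module k E] [AddCommMonoid F] [Module k F]

theorem exists_dual_ne_zero {x : E} (hx : x ≠ 0) : ∃ φ : Module.Dual k E, φ x ≠ 0 :=
  let _ := Module.addCommMonoidToAddCommGroup k (M := E)
  Module.Projective.exists_dual_ne_zero k hx

theorem exists_dual_extension (U : Submodule k E) (φ : Module.Dual k U) :
    ∃ ψ : Module.Dual k E, ∀ x : U, ψ x = φ x := by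
  let _ := Module.addCommMonoidToAddCommGroup k (M := E)
  obtain ⟨ψ, hψ⟩ := φ.exists_extend
  exact ⟨ψ, fun x => LinearMap.congr_fun hψ x⟩

/-- A map `f` that is injective modulo a subspace `K` has a left inverse vanishing on `K`. -/
theorem exists_leftInverse_vanishing (f : E →ₗ[k] F) (K : Submodule k F)
    (h : ∀ x, f x ∈ K → x = 0) : ∃ h : F →ₗ[k] E, (∀ x, h (f x) = x) ∧ ∀ y ∈ K, h y = 0 := by
  let _ := Module.addCommMonoidToAddCommGroup k (M := E)
  let _ := Module.addCommMonoidToAddCommGroup k (M := F)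
  have hinj : LinearMap.ker (K.mkQ ∘ₗ f) = ⊥ := by
    refine (Submodule.eq_bot_iff _).2 fun x hx => h x ?_
    simpa using hx
  obtain ⟨r, hr⟩ := LinearMap.exists_leftInverse_of_injective _ hinj
  refine ⟨r ∘ₗ K.mkQ, fun x => LinearMap.congr_fun hr x, fun y hy => ?_⟩
  have h0 : K.mkQ y = 0 := (Submodule.Quotient.mk_eq_zero K).2 hy
  rw [LinearMap.comp_apply, h0, map_zero]

end LinearAlgebra

/-! ### Functionals and gradings on a tensor algebra -/

section TensorAlgebra

open Polynomial

variable {k V : Type*} [Field k] [AddCommMonoid V] [Module k V]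

theorem tensorAlgebra_left_induction (S : Submodule k (TensorAlgebra k V)) (h1 : 1 ∈ S)
    (hι : ∀ (q : V), ∀ y ∈ S, TensorAlgebra.ι k q * y ∈ S) : S = ⊤ := by
  have key : ∀ x : TensorAlgebra k V, ∀ y ∈ S, x * y ∈ S := by
    intro x
    induction x using TensorAlgebra.induction with
    | algebraMap r =>
      intro y hy
      rw [← Algebra.smul_def]
      exact S.smul_mem r hy
    | ι q => exact hι q
    | mul a b ha hb =>
      intro y hy
      rw [mul_assoc]
      exact ha _ (hb y hy)
    | add a b ha hb =>
      intro y hy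
      rw [add_mul]
      exact S.add_mem (ha y hy) (hb y hy)
  refine (Submodule.eq_top_iff').2 fun x => ?_
  simpa using key x 1 h1

/-- The linear functional `Ψ` on `T(V)` with `Ψ(1) = 0` and `Ψ(q · y) = β(q, y)` for `q ∈ V`.  It is
read off from the action of `T(V)` on `T(V) × k` in which `q` sends `(y, t)` to `(q y, β(q, y))`. -/
def leftRec (β : V →ₗ[k] TensorAlgebra k V →ₗ[k] k) : TensorAlgebra k V →ₗ[k] k :=
  LinearMap.snd k _ k ∘ₗ LinearMap.applyₗ ((1 : TensorAlgebra k V), (0 : k)) ∘ₗ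
    (TensorAlgebra.lift k
      (A := Module.End k (TensorAlgebra k V × k))
      { toFun := fun q => LinearMap.prod
          (LinearMap.mulLeft k (TensorAlgebra.ι k q) ∘ₗ LinearMap.fst k _ k)
          (β q ∘ₗ LinearMap.fst k _ k)
        map_add' := fun q q' => by
          ext <;> simp [add_mul]
        map_smul' := fun c q => by
          ext <;> simp }).toLinearMap

theorem leftRec_one (β : V →ₗ[k] TensorAlgebra k V →ₗ[k] k) : leftRec β 1 = 0 := by
  simp [leftRec]

theorem leftRec_ι_mul (β : V →ₗ[k] TensorAlgebra k V →ₗ[k] k) (q : V) (y : TensorAlgebra k V) :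
    leftRec β (TensorAlgebra.ι k q * y) = β q y := by
  set ρ := TensorAlgebra.lift k
      (A := Module.End k (TensorAlgebra k V × k))
      { toFun := fun q => LinearMap.prod
          (LinearMap.mulLeft k (TensorAlgebra.ι k q) ∘ₗ LinearMap.fst k _ k)
          (β q ∘ₗ LinearMap.fst k _ k)
        map_add' := fun q q' => by
          ext <;> simp [add_mul]
        map_smul' := fun c q => by
          ext <;> simp } with hρ
  have hfst : ∀ y : TensorAlgebra k V, ∀ v, (ρ y v).1 = y * v.1 := by
    intro y
    induction y using TensorAlgebra.induction with
    | algebraMap r => intro v; simp [Algebra.smul_def]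
    | ι q => intro v; simp [hρ]
    | mul a b ha hb => intro v; simp [ha, hb, mul_assoc]
    | add a b ha hb => intro v; simp [ha, hb, add_mul]
  have h1 : leftRec β (TensorAlgebra.ι k q * y) =
      (ρ (TensorAlgebra.ι k q * y) (1, 0)).2 := rfl
  rw [h1, map_mul, Module.End.mul_apply]
  have h2 : ∀ v, (ρ (TensorAlgebra.ι k q) v).2 = β q v.1 := by
    intro v
    simp [hρ]
  rw [h2, hfst, mul_one]

/-- The functional `φ₁ ⊗ ⋯ ⊗ φₙ` on `T(V)`, supported on tensor length `n`. -/
def tensorFunctional {n : ℕ} (φ : Fin n → Module.Dual k V) : TensorAlgebra k V →ₗ[k] k :=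
  PiTensorProduct.lift ((MultilinearMap.mkPiAlgebra k (Fin n) k).compLinearMap φ) ∘ₗ
    DirectSum.component k ℕ (fun n => ⨂[k]^n V) n ∘ₗ TensorAlgebra.toDirectSum.toLinearMap

theorem tensorFunctional_tprod {n : ℕ} (φ : Fin n → Module.Dual k V) (v : Fin n → V) :
    tensorFunctional φ (TensorAlgebra.tprod k V n v) = ∏ i, φ i (v i) := by
  simp only [tensorFunctional, LinearMap.comp_apply, AlgHom.toLinearMap_apply,
    TensorAlgebra.toDirectSum_tensorPower_tprod]
  erw [DirectSum.component.lof_self]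
  simp

theorem tensorFunctional_tprod_of_ne {n m : ℕ} (h : m ≠ n) (φ : Fin n → Module.Dual k V)
    (v : Fin m → V) : tensorFunctional φ (TensorAlgebra.tprod k V m v) = 0 := by
  simp only [tensorFunctional, LinearMap.comp_apply, AlgHom.toLinearMap_apply,
    TensorAlgebra.toDirectSum_tensorPower_tprod]
  have : DirectSum.component k ℕ (fun n => ⨂[k]^n V) n
      (DirectSum.of (fun n => ⨂[k]^n V) m (PiTensorProduct.tprod k v)) = 0 :=
    DirectSum.of_eq_of_ne _ _ _ h.symm
  rw [this, map_zero]

theorem ι_mul_tprod {n : ℕ} (q : V) (v : Fin n → V) :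
    TensorAlgebra.ι k q * TensorAlgebra.tprod k V n v =
      TensorAlgebra.tprod k V (n + 1) (Fin.cons q v) := by
  simp [TensorAlgebra.tprod_apply, List.ofFn_succ]

theorem span_range_tprod :
    Submodule.span k {x | ∃ (n : ℕ) (v : Fin n → V), x = TensorAlgebra.tprod k V n v} = ⊤ := by
  refine tensorAlgebra_left_induction _ (Submodule.subset_span ⟨0, ![], ?_⟩) fun q y hy => ?_
  · simp
  · refine Submodule.span_induction (p := fun y _ => TensorAlgebra.ι k q * y ∈ _) ?_ ?_ ?_ ?_ hy
    · rintro _ ⟨n, v, rfl⟩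
      exact Submodule.subset_span ⟨n + 1, _, ι_mul_tprod q v⟩
    · simp
    · intro a b _ _ ha hb
      rw [mul_add]
      exact Submodule.add_mem _ ha hb
    · intro c a _ ha
      rw [mul_smul_comm]
      exact Submodule.smul_mem _ c ha

theorem tensorFunctional_ι_mul {n : ℕ} (φ : Fin (n + 1) → Module.Dual k V) (q : V)
    (y : TensorAlgebra k V) :
    tensorFunctional φ (TensorAlgebra.ι k q * y) =
      φ 0 q * tensorFunctional (fun i => φ i.succ) y := by
  have hy : y ∈ Submodule.span k
      {x | ∃ (n : ℕ) (v : Fin n → V), x = TensorAlgebra.tprod k V n v} := by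
    rw [span_range_tprod]; trivial
  induction hy using Submodule.span_induction with
  | mem y h =>
    obtain ⟨m, v, rfl⟩ := h
    rw [ι_mul_tprod]
    by_cases hm : m = n
    · subst hm
      rw [tensorFunctional_tprod, tensorFunctional_tprod, Fin.prod_univ_succ]
      simp
    · rw [tensorFunctional_tprod_of_ne (by omega), tensorFunctional_tprod_of_ne hm, mul_zero]
  | zero => simp
  | add a b _ _ ha hb => rw [mul_add, map_add, map_add, ha, hb, mul_add]
  | smul c a _ ha =>
    rw [mul_smul_comm, map_smul, map_smul, ha, smul_eq_mul, smul_eq_mul]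
    ring

theorem tensorFunctional_zero_ι_mul (φ : Fin 0 → Module.Dual k V) (q : V)
    (y : TensorAlgebra k V) : tensorFunctional φ (TensorAlgebra.ι k q * y) = 0 := by
  have hy : y ∈ Submodule.span k
      {x | ∃ (n : ℕ) (v : Fin n → V), x = TensorAlgebra.tprod k V n v} := by
    rw [span_range_tprod]; trivial
  induction hy using Submodule.span_induction with
  | mem y h =>
    obtain ⟨m, v, rfl⟩ := h
    rw [ι_mul_tprod, tensorFunctional_tprod_of_ne (by omega)]
  | zero => simp
  | add a b _ _ ha hb => rw [mul_add, map_add, ha, hb, add_zero]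
  | smul c a _ ha => rw [mul_smul_comm, map_smul, ha, smul_zero]

theorem tensorFunctional_ι {n : ℕ} (φ : Fin (n + 1) → Module.Dual k V) (q : V) :
    tensorFunctional φ (TensorAlgebra.ι k q) = if n = 0 then φ 0 q else 0 := by
  have h : TensorAlgebra.ι k q = TensorAlgebra.tprod k V 1 (fun _ => q) := by simp
  rw [h]
  split_ifs with hn
  · subst hn
    rw [tensorFunctional_tprod]
    simp
  · rw [tensorFunctional_tprod_of_ne (by omega)]

theorem isInternal_of_proj {N : Type*} [AddCommMonoid N] [Module k N] {W : ℕ → Submodule k V}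
    (j : V →ₗ[k] N) (hj : Function.Injective j) (p : ℕ → V →ₗ[k] N)
    (hp : ∀ s, ∀ x ∈ W s, p s x = j x) (hp' : ∀ s t, t ≠ s → ∀ x ∈ W t, p s x = 0)
    (hsup : ⨆ s, W s = ⊤) : DirectSum.IsInternal W := by
  have key : ∀ (x : ⨁ s, W s) (s : ℕ), p s (DirectSum.coeLinearMap W x) = j (x s) := by
    intro x s
    induction x using DirectSum.induction_on with
    | zero => simp
    | of t y =>
      have h : DirectSum.coeLinearMap W (DirectSum.of (fun s => W s) t y) = y :=
        DirectSum.coeLinearMap_lof W t y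
      rw [h]
      by_cases hts : t = s
      · subst hts
        rw [hp t y y.2, DirectSum.of_eq_same]
      · rw [hp' s t hts y y.2, DirectSum.of_eq_of_ne _ _ _ (Ne.symm hts)]
        simp
    | add x y hx hy => simp [hx, hy]
  constructor
  · intro x y hxy
    ext s
    apply hj
    rw [← key, ← key]
    exact congrArg _ hxy
  · have h : LinearMap.range (DirectSum.coeLinearMap W) = ⊤ := by
      rw [eq_top_iff, ← hsup]
      refine iSup_le fun s x hx => ⟨DirectSum.lof k ℕ (fun s => W s) s ⟨x, hx⟩, ?_⟩
      exact DirectSum.coeLinearMap_lof W s ⟨x, hx⟩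
    exact LinearMap.range_eq_top.1 h

variable {W : ℕ → Submodule k V} (hW : DirectSum.IsInternal W)

/-- For a graded vector space `V = ⨁ Wₜ`, the algebra map `δ : T(V) → T(V)[X]` with
`δ(q) = q Xᵗ` for `q ∈ Wₜ`.  The coefficients of `δ` are the projections to the weights. -/
def weightHom : TensorAlgebra k V →ₐ[k] (TensorAlgebra k V)[X] :=
  TensorAlgebra.lift k
    (DirectSum.toModule k ℕ (TensorAlgebra k V)[X] (fun t =>
      (Polynomial.monomial (R := TensorAlgebra k V) t).restrictScalars k ∘ₗ
        TensorAlgebra.ι k ∘ₗ (W t).subtype) ∘ₗ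
      (LinearEquiv.ofBijective (DirectSum.coeLinearMap W) hW).symm.toLinearMap)

theorem weightHom_ι {t : ℕ} {q : V} (hq : q ∈ W t) :
    weightHom hW (TensorAlgebra.ι k q) = Polynomial.monomial t (TensorAlgebra.ι k q) := by
  have h : (LinearEquiv.ofBijective (DirectSum.coeLinearMap W) hW).symm q =
      DirectSum.lof k ℕ (fun t => W t) t ⟨q, hq⟩ := by
    rw [LinearEquiv.symm_apply_eq]
    exact (DirectSum.coeLinearMap_lof W t ⟨q, hq⟩).symm
  simp [weightHom, h]

/-- The component of weight `t` of an element of `T(V)`. -/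
def weightComp (t : ℕ) : TensorAlgebra k V →ₗ[k] TensorAlgebra k V where
  toFun x := (weightHom hW x).coeff t
  map_add' x y := by simp
  map_smul' c x := by simp

theorem weightComp_def (t : ℕ) (x : TensorAlgebra k V) :
    weightComp hW t x = (weightHom hW x).coeff t := rfl

theorem weightComp_mul (t : ℕ) (x y : TensorAlgebra k V) :
    weightComp hW t (x * y) =
      ∑ p ∈ Finset.HasAntidiagonal.antidiagonal t, weightComp hW p.1 x * weightComp hW p.2 y := by
  simp only [weightComp_def, map_mul, Polynomial.coeff_mul]

theorem span_homogeneous_eq_top (hW : DirectSum.IsInternal W) :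
    Submodule.span k {q : V | ∃ t, q ∈ W t} = ⊤ := by
  rw [eq_top_iff, ← hW.submodule_iSup_eq_top]
  exact iSup_le fun t q hq => Submodule.subset_span ⟨t, hq⟩

theorem eval_one_weightHom (x : TensorAlgebra k V) : (weightHom hW x).eval 1 = x := by
  induction x using TensorAlgebra.induction with
  | algebraMap r => simp [Polynomial.algebraMap_apply]
  | ι q =>
    have hq : q ∈ Submodule.span k {q : V | ∃ t, q ∈ W t} := by
      rw [span_homogeneous_eq_top hW]; trivial
    induction hq using Submodule.span_induction with
    | mem q h =>
      obtain ⟨t, ht⟩ := h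
      simp [weightHom_ι hW ht]
    | zero => simp
    | add a b _ _ ha hb => simp only [map_add, eval_add, ha, hb]
    | smul c a _ ha => simp only [map_smul, eval_smul, ha]
  | mul a b ha hb =>
    rw [map_mul, Polynomial.eval, Polynomial.eval₂_mul_noncomm _ _ fun _ => Commute.one_right _]
    exact congrArg₂ _ ha hb
  | add a b ha hb => simp only [map_add, eval_add, ha, hb]

theorem mem_of_weightComp_mem (S : Submodule k (TensorAlgebra k V)) {x : TensorAlgebra k V}
    (h : ∀ t, weightComp hW t x ∈ S) : x ∈ S := by
  rw [← eval_one_weightHom hW x, Polynomial.eval_eq_sum, Polynomial.sum]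
  refine Submodule.sum_mem _ fun t _ => ?_
  rw [one_pow, mul_one]
  exact h t

theorem weightComp_zero (hW0 : W 0 = ⊥) (x : TensorAlgebra k V) :
    weightComp hW 0 x = algebraMap k _ (TensorAlgebra.algebraMapInv x) := by
  induction x using TensorAlgebra.induction with
  | algebraMap r =>
    simp [weightComp_def, Polynomial.algebraMap_apply, TensorAlgebra.algebraMap_leftInverse V r]
  | ι q =>
    have hq : q ∈ Submodule.span k {q : V | ∃ t, q ∈ W t} := by
      rw [span_homogeneous_eq_top hW]; trivial
    induction hq using Submodule.span_induction with
    | mem q h =>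
      obtain ⟨t, ht⟩ := h
      rw [weightComp_def, weightHom_ι hW ht, Polynomial.coeff_monomial]
      split_ifs with h0
      · subst h0
        rw [hW0, Submodule.mem_bot] at ht
        simp [ht]
      · simp [TensorAlgebra.algebraMapInv]
    | zero => simp
    | add a b _ _ ha hb => simp only [map_add, ha, hb]
    | smul c a _ ha =>
      rw [map_smul, map_smul, ha, map_smul, Algebra.smul_def, smul_eq_mul, map_mul]
  | mul a b ha hb =>
    rw [weightComp_mul]
    simp [ha, hb]
  | add a b ha hb => simp only [map_add, ha, hb]

/-- The components of an element are homogeneous. -/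
theorem weightComp_idem (t : ℕ) (x : TensorAlgebra k V) :
    weightHom hW (weightComp hW t x) = Polynomial.monomial t (weightComp hW t x) := by
  induction x using TensorAlgebra.induction generalizing t with
  | algebraMap r =>
    simp only [weightComp_def, AlgHom.commutes, Polynomial.algebraMap_apply, coeff_C]
    split_ifs with h
    · subst h; simp [Polynomial.algebraMap_apply]
    · simp
  | ι q =>
    have hq : q ∈ Submodule.span k {q : V | ∃ t, q ∈ W t} := by
      rw [span_homogeneous_eq_top hW]; trivial
    induction hq using Submodule.span_induction with
    | mem q h =>
      obtain ⟨u, hu⟩ := h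
      rw [weightComp_def, weightHom_ι hW hu, Polynomial.coeff_monomial]
      split_ifs with h0
      · subst h0
        rw [weightHom_ι hW hu]
      · simp
    | zero => simp
    | add a b _ _ ha hb => simp only [map_add, ha, hb]
    | smul c a _ ha => simp only [map_smul, ha, Polynomial.smul_monomial]
  | mul a b ha hb =>
    rw [weightComp_mul, map_sum, map_sum]
    refine Finset.sum_congr rfl fun p hp => ?_
    rw [map_mul, ha, hb, Polynomial.monomial_mul_monomial, Finset.HasAntidiagonal.mem_antidiagonal.mp hp]
  | add a b ha hb => simp only [map_add, ha, hb]

theorem weightComp_of_homogeneous {t : ℕ} {x : TensorAlgebra k V}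
    (hx : weightHom hW x = Polynomial.monomial t x) (u : ℕ) :
    weightComp hW u x = if t = u then x else 0 := by
  rw [weightComp_def, hx, Polynomial.coeff_monomial]

theorem weightComp_mem_span (S : Set (TensorAlgebra k V))
    (hS : ∀ x ∈ S, ∃ t, weightHom hW x = Polynomial.monomial t x) (t : ℕ)
    {x : TensorAlgebra k V} (hx : x ∈ TwoSidedIdeal.span S) :
    weightComp hW t x ∈ TwoSidedIdeal.span S := by
  revert t
  induction hx using TwoSidedIdeal.span_induction with
  | mem x h =>
    intro t
    obtain ⟨u, hu⟩ := hS x h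
    rw [weightComp_of_homogeneous hW hu]
    split_ifs
    · exact TwoSidedIdeal.subset_span h
    · exact TwoSidedIdeal.zero_mem _
  | zero => intro t; rw [map_zero]; exact TwoSidedIdeal.zero_mem _
  | add x y _ _ hx hy => intro t; rw [map_add]; exact TwoSidedIdeal.add_mem _ (hx t) (hy t)
  | neg x _ hx => intro t; rw [map_neg]; exact TwoSidedIdeal.neg_mem _ (hx t)
  | left_absorb a x _ hx =>
    intro t
    rw [weightComp_mul]
    exact sum_mem fun p _ => TwoSidedIdeal.mul_mem_left _ _ _ (hx _)
  | right_absorb a x _ hx =>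
    intro t
    rw [weightComp_mul]
    exact sum_mem fun p _ => TwoSidedIdeal.mul_mem_right _ _ _ (hx _)

/-- A two-sided ideal of `T(V)` as a subspace. -/
def idealSubmodule (I : TwoSidedIdeal (TensorAlgebra k V)) : Submodule k (TensorAlgebra k V) where
  carrier := {x | x ∈ I}
  add_mem' := I.add_mem
  zero_mem' := I.zero_mem
  smul_mem' c x hx := by
    simp only [Set.mem_ofPred_eq] at *
    rw [Algebra.smul_def]
    exact I.mul_mem_left _ _ hx

/-- `F₊ I + I F₊` for a two-sided ideal `I` of `F = T(V)`, where `F₊` is the augmentation ideal. -/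
def decomposableRelations (I : TwoSidedIdeal (TensorAlgebra k V)) :
    Submodule k (TensorAlgebra k V) :=
  Submodule.span k {z | ∃ x ∈ I, ∃ y : TensorAlgebra k V,
    TensorAlgebra.algebraMapInv y = 0 ∧ (z = y * x ∨ z = x * y)}

theorem mul_mem_decomposableRelations {I : TwoSidedIdeal (TensorAlgebra k V)}
    {z : TensorAlgebra k V} (hz : z ∈ decomposableRelations I) (a : TensorAlgebra k V) :
    a * z ∈ decomposableRelations I ∧ z * a ∈ decomposableRelations I := by
  induction hz using Submodule.span_induction with
  | mem z h =>
    obtain ⟨x, hx, y, hy, rfl | rfl⟩ := h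
    · refine ⟨Submodule.subset_span ⟨x, hx, a * y, by simp [hy], .inl (mul_assoc _ _ _).symm⟩,
        Submodule.subset_span ⟨x * a, I.mul_mem_right _ _ hx, y, hy, .inl (mul_assoc _ _ _)⟩⟩
    · refine ⟨Submodule.subset_span ⟨a * x, I.mul_mem_left _ _ hx, y, hy,
        .inr (mul_assoc _ _ _).symm⟩,
        Submodule.subset_span ⟨x, hx, y * a, by simp [hy], .inr (mul_assoc _ _ _)⟩⟩
  | zero => simp
  | add x y _ _ hx hy =>
    rw [mul_add, add_mul]
    exact ⟨Submodule.add_mem _ hx.1 hy.1, Submodule.add_mem _ hx.2 hy.2⟩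
  | smul c x _ hx =>
    rw [mul_smul_comm, smul_mul_assoc]
    exact ⟨Submodule.smul_mem _ c hx.1, Submodule.smul_mem _ c hx.2⟩

theorem weightComp_mem_decomposableRelations {I : TwoSidedIdeal (TensorAlgebra k V)}
    (hW0 : W 0 = ⊥) (hI : ∀ x ∈ I, ∀ t, weightComp hW t x ∈ I)
    {z : TensorAlgebra k V} (hz : z ∈ decomposableRelations I) (t : ℕ) :
    weightComp hW t z ∈ decomposableRelations I := by
  induction hz using Submodule.span_induction with
  | mem z h =>
    obtain ⟨x, hx, y, hy, h⟩ := h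
    have hy' : ∀ u, TensorAlgebra.algebraMapInv (weightComp hW u y) = 0 := by
      intro u
      have h0 := weightComp_zero hW hW0 (weightComp hW u y)
      rw [weightComp_of_homogeneous hW (weightComp_idem hW u y)] at h0
      rcases eq_or_ne u 0 with rfl | hu
      · rw [weightComp_zero hW hW0, hy]; simp
      · rw [if_neg hu, eq_comm, TensorAlgebra.algebraMap_eq_zero_iff] at h0
        exact h0
    rcases h with rfl | rfl
    · rw [weightComp_mul]
      exact Submodule.sum_mem _ fun p _ =>
        Submodule.subset_span ⟨_, hI x hx p.2, _, hy' p.1, .inl rfl⟩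
    · rw [weightComp_mul]
      exact Submodule.sum_mem _ fun p _ =>
        Submodule.subset_span ⟨_, hI x hx p.1, _, hy' p.2, .inr rfl⟩
  | zero => simp
  | add x y _ _ hx hy => rw [map_add]; exact Submodule.add_mem _ hx hy
  | smul c x _ hx => rw [map_smul]; exact Submodule.smul_mem _ c hx

/-- Graded Nakayama lemma: if a homogeneous ideal `J` contained in the homogeneous ideal
`I` contains generators of `I` modulo `F₊ I + I F₊`, then it is all of `I`. -/
theorem span_le_of_sub_mem_decomposableRelations (hW0 : W 0 = ⊥) {S : Set (TensorAlgebra k V)}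
    {J : TwoSidedIdeal (TensorAlgebra k V)}
    (hS : ∀ x ∈ S, ∃ t, weightHom hW x = Polynomial.monomial t x)
    (hJ : ∀ x ∈ J, ∀ t, weightComp hW t x ∈ J)
    (hgen : ∀ x ∈ S, ∃ y ∈ J, x - y ∈ decomposableRelations (TwoSidedIdeal.span S)) :
    TwoSidedIdeal.span S ≤ J := by
  set I := TwoSidedIdeal.span S
  have hI : ∀ x ∈ I, ∀ t, weightComp hW t x ∈ I := fun x hx t => weightComp_mem_span hW S hS t hx
  have hmod : ∀ x ∈ I, ∃ y ∈ J, x - y ∈ decomposableRelations I := by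
    intro x hx
    induction hx using TwoSidedIdeal.span_induction with
    | mem x h => exact hgen x h
    | zero => exact ⟨0, J.zero_mem, by simp⟩
    | add x y _ _ hx hy =>
      obtain ⟨a, ha, ha'⟩ := hx
      obtain ⟨b, hb, hb'⟩ := hy
      exact ⟨a + b, J.add_mem ha hb, by rw [add_sub_add_comm]; exact Submodule.add_mem _ ha' hb'⟩
    | neg x _ hx =>
      obtain ⟨a, ha, ha'⟩ := hx
      exact ⟨-a, J.neg_mem ha, by rw [← neg_sub']; exact Submodule.neg_mem _ ha'⟩
    | left_absorb a x _ hx =>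
      obtain ⟨y, hy, hy'⟩ := hx
      exact ⟨a * y, J.mul_mem_left _ _ hy, by
        rw [← mul_sub]; exact (mul_mem_decomposableRelations hy' a).1⟩
    | right_absorb a x _ hx =>
      obtain ⟨y, hy, hy'⟩ := hx
      exact ⟨y * a, J.mul_mem_right _ _ hy, by
        rw [← sub_mul]; exact (mul_mem_decomposableRelations hy' a).2⟩
  -- a factor in `F₊` has positive weight, so the other factor has weight less than `t`
  have hcomp : ∀ t, ∀ x ∈ I, weightComp hW t x ∈ J := by
    intro t
    induction t using Nat.strong_induction_on with
    | _ t ih =>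
      have hdec : ∀ z ∈ decomposableRelations I, weightComp hW t z ∈ J := by
        intro z hz
        induction hz using Submodule.span_induction with
        | mem z h =>
          obtain ⟨x, hx, y, hy, h⟩ := h
          have hy0 : weightComp hW 0 y = 0 := by rw [weightComp_zero hW hW0, hy, map_zero]
          rcases h with rfl | rfl
          · rw [weightComp_mul]
            refine sum_mem fun p hp => ?_
            rw [Finset.HasAntidiagonal.mem_antidiagonal] at hp
            rcases Nat.eq_zero_or_pos p.1 with h0 | h0
            · rw [h0, hy0, zero_mul]; exact J.zero_mem
            · exact J.mul_mem_left _ _ (ih _ (by omega) x hx)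
          · rw [weightComp_mul]
            refine sum_mem fun p hp => ?_
            rw [Finset.HasAntidiagonal.mem_antidiagonal] at hp
            rcases Nat.eq_zero_or_pos p.2 with h0 | h0
            · rw [h0, hy0, mul_zero]; exact J.zero_mem
            · exact J.mul_mem_right _ _ (ih _ (by omega) x hx)
        | zero => rw [map_zero]; exact J.zero_mem
        | add x y _ _ hx hy => rw [map_add]; exact J.add_mem hx hy
        | smul c x _ hx => rw [map_smul]; exact (idealSubmodule J).smul_mem c hx
      intro x hx
      obtain ⟨y, hy, hxy⟩ := hmod x hx
      have := J.add_mem (hdec _ hxy) (hJ y hy t)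
      rwa [← map_add, sub_add_cancel] at this
  exact fun x hx => mem_of_weightComp_mem hW (idealSubmodule J) fun t => hcomp t x hx

end TensorAlgebra

/-! ### The grading of the augmentation ideal, and generators -/

section AugIdeal

variable {k A : Type*} [Field k] [Ring A] [Algebra k A]
variable (𝒜 : ℕ → Submodule k A) [GradedAlgebra 𝒜]

theorem mem_augPart {s : ℕ} {a : augIdeal 𝒜} : a ∈ augPart 𝒜 s ↔ (a : A) ∈ 𝒜 s := Iff.rfl

theorem mem_augIdeal {a : A} : a ∈ augIdeal 𝒜 ↔ GradedRing.projZeroRingHom 𝒜 a = 0 := Iff.rfl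

/-- The projection of `𝔪` to its component `A_s`. -/
def augProj (s : ℕ) : augIdeal 𝒜 →ₗ[k] augIdeal 𝒜 where
  toFun a := ⟨GradedAlgebra.proj 𝒜 s a, by
    have ha : ((DirectSum.decompose 𝒜 (a : A)) 0 : A) = 0 := a.2
    rw [mem_augIdeal, GradedRing.projZeroRingHom_apply, GradedAlgebra.proj_apply]
    rcases eq_or_ne s 0 with rfl | hs
    · rw [ha]; simp
    · exact DirectSum.decompose_of_mem_ne 𝒜 (SetLike.coe_mem _) hs⟩
  map_add' a b := Subtype.ext (by simp)
  map_smul' c a := Subtype.ext (by simp)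

theorem coe_augProj (s : ℕ) (a : augIdeal 𝒜) :
    (augProj 𝒜 s a : A) = (DirectSum.decompose 𝒜 (a : A) s : A) := rfl

theorem augProj_mem (s : ℕ) (a : augIdeal 𝒜) : augProj 𝒜 s a ∈ augPart 𝒜 s := by
  rw [mem_augPart, coe_augProj]
  exact SetLike.coe_mem _

theorem augProj_of_mem {s : ℕ} {a : augIdeal 𝒜} (ha : a ∈ augPart 𝒜 s) : augProj 𝒜 s a = a :=
  Subtype.ext (DirectSum.decompose_of_mem_same 𝒜 ha)

theorem augProj_of_mem_ne {s t : ℕ} {a : augIdeal 𝒜} (ha : a ∈ augPart 𝒜 t) (h : t ≠ s) :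
    augProj 𝒜 s a = 0 :=
  Subtype.ext (DirectSum.decompose_of_mem_ne 𝒜 ha h)

theorem iSup_augPart : ⨆ s, augPart 𝒜 s = ⊤ := by
  classical
  refine (Submodule.eq_top_iff').2 fun a => ?_
  have h : a = ∑ s ∈ (DirectSum.decompose 𝒜 (a : A)).support, augProj 𝒜 s a := by
    apply Subtype.ext
    have hc : ((∑ s ∈ (DirectSum.decompose 𝒜 (a : A)).support, augProj 𝒜 s a : augIdeal 𝒜) : A) =
        ∑ s ∈ (DirectSum.decompose 𝒜 (a : A)).support, (augProj 𝒜 s a : A) :=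
      map_sum (augIdeal 𝒜).toSubmodule.subtype _ _
    rw [hc]
    exact (DirectSum.sum_support_decompose 𝒜 (a : A)).symm
  rw [h]
  exact Submodule.sum_mem _ fun s _ => Submodule.mem_iSup_of_mem s (augProj_mem 𝒜 s a)

theorem augPart_zero : augPart 𝒜 0 = ⊥ := by
  refine (Submodule.eq_bot_iff _).2 fun a ha => ?_
  rw [← augProj_of_mem 𝒜 ha]
  exact Subtype.ext a.2

theorem mul_mem_augPart {i j : ℕ} {a b : augIdeal 𝒜} (ha : a ∈ augPart 𝒜 i)
    (hb : b ∈ augPart 𝒜 j) : a * b ∈ augPart 𝒜 (i + j) :=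
  SetLike.mul_mem_graded (A := 𝒜) ha hb

theorem augIdeal_le_of_augPart_le {S : Submodule k (augIdeal 𝒜)} (h : ∀ s, augPart 𝒜 s ≤ S)
    (a : augIdeal 𝒜) : a ∈ S := by
  have : (⊤ : Submodule k (augIdeal 𝒜)) ≤ S := by
    rw [← iSup_augPart]
    exact iSup_le h
  exact this trivial

theorem eq_of_augProj_eq {a b : augIdeal 𝒜} (h : ∀ s, augProj 𝒜 s a = augProj 𝒜 s b) : a = b := by
  apply Subtype.ext
  apply (DirectSum.decompose 𝒜).injective
  refine DFinsupp.ext fun s => Subtype.ext ?_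
  exact congrArg (fun a : augIdeal 𝒜 => (a : A)) (h s)

theorem mul_mem_decomposables (a b : augIdeal 𝒜) : a * b ∈ decomposables 𝒜 :=
  Submodule.subset_span ⟨a, b, rfl⟩

theorem augProj_mem_decomposables (s : ℕ) {a : augIdeal 𝒜} (ha : a ∈ decomposables 𝒜) :
    augProj 𝒜 s a ∈ decomposables 𝒜 := by
  suffices h : decomposables 𝒜 ≤ (decomposables 𝒜).comap (augProj 𝒜 s) from h ha
  refine Submodule.span_le.2 ?_
  rintro _ ⟨a, b, rfl⟩
  have h1 : ∀ a : augIdeal 𝒜,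
      a ∈ (((decomposables 𝒜).comap (augProj 𝒜 s)).comap (LinearMap.mulRight k b)) := by
    refine augIdeal_le_of_augPart_le 𝒜 fun i (a : augIdeal 𝒜) (ha : a ∈ augPart 𝒜 i) => ?_
    have h2 : ∀ b : augIdeal 𝒜,
        b ∈ (((decomposables 𝒜).comap (augProj 𝒜 s)).comap (LinearMap.mulLeft k a)) := by
      refine augIdeal_le_of_augPart_le 𝒜 fun j (b : augIdeal 𝒜) (hb : b ∈ augPart 𝒜 j) => ?_
      change augProj 𝒜 s (a * b) ∈ decomposables 𝒜
      by_cases h : i + j = s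
      · subst h
        rw [augProj_of_mem 𝒜 (mul_mem_augPart 𝒜 ha hb)]
        exact mul_mem_decomposables 𝒜 a b
      · rw [augProj_of_mem_ne 𝒜 (mul_mem_augPart 𝒜 ha hb) h]
        exact Submodule.zero_mem _
    exact h2 b
  exact h1 a

end AugIdeal

namespace Generators

variable {k A : Type*} [Field k] [Ring A] [Algebra k A]
variable {𝒜 : ℕ → Submodule k A} [GradedAlgebra 𝒜] (g : Generators 𝒜)

theorem Q_le_augPart (s : ℕ) : g.Q s ≤ augPart 𝒜 s := by
  rw [← g.Q_sup_D s]
  exact le_sup_left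

theorem Q_le_tot (s : ℕ) : g.Q s ≤ g.tot := le_iSup g.Q s

theorem Q_zero : g.Q 0 = ⊥ := by
  have := g.Q_le_augPart 0
  rwa [augPart_zero, le_bot_iff] at this

theorem augProj_mem_Q (s : ℕ) {q : augIdeal 𝒜} (hq : q ∈ g.tot) : augProj 𝒜 s q ∈ g.Q s := by
  suffices h : g.tot ≤ (g.Q s).comap (augProj 𝒜 s) from h hq
  refine iSup_le fun t q hq => ?_
  rw [Submodule.mem_comap]
  by_cases h : t = s
  · subst h
    rwa [augProj_of_mem 𝒜 (g.Q_le_augPart t hq)]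
  · rw [augProj_of_mem_ne 𝒜 (g.Q_le_augPart t hq) h]
    exact Submodule.zero_mem _

/-- `𝔪 = Q ⊕ 𝔪²`. -/
theorem isCompl_tot_decomposables : IsCompl g.tot (decomposables 𝒜) := by
  constructor
  · rw [Submodule.disjoint_def]
    intro x hx hx'
    refine eq_of_augProj_eq 𝒜 fun s => ?_
    rw [map_zero]
    exact (Submodule.disjoint_def.1 (g.disjoint_Q_D s)) _ (g.augProj_mem_Q s hx)
      ⟨augProj_mem_decomposables 𝒜 s hx', augProj_mem 𝒜 s x⟩
  · rw [codisjoint_iff, eq_top_iff, ← iSup_augPart]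
    refine iSup_le fun s => ?_
    rw [← g.Q_sup_D s]
    exact sup_le_sup (g.Q_le_tot s) inf_le_left

/-- `Q_s` as a subspace of `Q`. -/
def genPart (s : ℕ) : Submodule k g.tot := (g.Q s).comap g.tot.subtype

theorem genPart_zero : g.genPart 0 = ⊥ := by
  rw [genPart, Q_zero]
  exact Submodule.ker_subtype _

theorem isInternal_genPart : DirectSum.IsInternal g.genPart := by
  refine isInternal_of_proj g.tot.subtype Subtype.val_injective
    (fun s => augProj 𝒜 s ∘ₗ g.tot.subtype)
    (fun s x hx => augProj_of_mem 𝒜 (g.Q_le_augPart s hx))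
    (fun s t ht x hx => augProj_of_mem_ne 𝒜 (g.Q_le_augPart t hx) ht) ?_
  · refine (Submodule.eq_top_iff').2 fun x => ?_
    have h : g.tot ≤ (⨆ s, g.genPart s).map g.tot.subtype := by
      refine iSup_le fun s q hq => ?_
      exact ⟨⟨q, g.Q_le_tot s hq⟩, Submodule.mem_iSup_of_mem s hq, rfl⟩
    obtain ⟨y, hy, hyx⟩ := h x.2
    rwa [Subtype.ext hyx] at hy

theorem weightHom_gen {i : ℕ} {q : g.tot} (hq : (q : augIdeal 𝒜) ∈ g.Q i) :
    weightHom g.isInternal_genPart (TensorAlgebra.ι k q) =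
      Polynomial.monomial i (TensorAlgebra.ι k q) :=
  weightHom_ι g.isInternal_genPart (t := i) hq

/-- The projection `𝔪 → Q` along `𝔪²`. -/
def projGen : augIdeal 𝒜 →ₗ[k] g.tot := g.tot.projectionOnto _ g.isCompl_tot_decomposables

/-- The projection `𝔪 → 𝔪²` along `Q`. -/
def projDec : augIdeal 𝒜 →ₗ[k] decomposables 𝒜 :=
  (decomposables 𝒜).projectionOnto _ g.isCompl_tot_decomposables.symm

theorem projGen_of_mem (q : g.tot) : g.projGen q = q :=
  Submodule.projectionOnto_apply_left _ q

theorem projGen_of_dec {x : augIdeal 𝒜} (hx : x ∈ decomposables 𝒜) : g.projGen x = 0 :=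
  Submodule.projectionOnto_apply_of_mem_right _ hx

theorem projDec_of_mem (x : decomposables 𝒜) : g.projDec x = x :=
  Submodule.projectionOnto_apply_left _ x

theorem projDec_of_gen {q : augIdeal 𝒜} (hq : q ∈ g.tot) : g.projDec q = 0 :=
  Submodule.projectionOnto_apply_of_mem_right _ hq

theorem proj_mem_augPart {s : ℕ} {a : augIdeal 𝒜} (ha : a ∈ augPart 𝒜 s) :
    (g.projGen a : augIdeal 𝒜) ∈ augPart 𝒜 s ∧ (g.projDec a : augIdeal 𝒜) ∈ augPart 𝒜 s := by
  rw [← g.Q_sup_D s] at ha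
  obtain ⟨q, hq, x, hx, rfl⟩ := Submodule.mem_sup.1 ha
  rw [map_add, map_add, g.projGen_of_dec hx.1, g.projDec_of_gen (g.Q_le_tot s hq), add_zero,
    zero_add]
  have h1 := g.projGen_of_mem ⟨q, g.Q_le_tot s hq⟩
  have h2 := g.projDec_of_mem ⟨x, hx.1⟩
  exact ⟨by rw [h1]; exact g.Q_le_augPart s hq, by rw [h2]; exact hx.2⟩

theorem exists_eq_add (a : augIdeal 𝒜) :
    ∃ q : g.tot, ∃ x : decomposables 𝒜, a = (q : augIdeal 𝒜) + x := by
  have : a ∈ g.tot ⊔ decomposables 𝒜 := by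
    rw [g.isCompl_tot_decomposables.sup_eq_top]; trivial
  obtain ⟨q, hq, x, hx, h⟩ := Submodule.mem_sup.1 this
  exact ⟨⟨q, hq⟩, ⟨x, hx⟩, h.symm⟩

theorem freeMul_ι (q : g.tot) : g.freeMul (TensorAlgebra.ι k q) = ((q : augIdeal 𝒜) : A) := by
  simp [freeMul]

theorem extend_tmul (θ : augIdeal 𝒜 →ₗ[k] TensorAlgebra k g.tot) (q : g.tot) (a : augIdeal 𝒜) :
    g.extend θ (q ⊗ₜ[k] a) = TensorAlgebra.ι k q * θ a := by
  simp [extend]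

theorem QAIncl_tmul (q : g.tot) (a : augIdeal 𝒜) :
    g.QAIncl (q ⊗ₜ[k] a) = (q : augIdeal 𝒜) ⊗ₜ[k] a := by
  simp [QAIncl]

theorem QAMul_tmul (q : g.tot) (a : augIdeal 𝒜) :
    g.QAMul (q ⊗ₜ[k] a) = (q : augIdeal 𝒜) * a := by
  simp [QAMul, QAIncl_tmul]

theorem algebraMapInv_extend (θ : augIdeal 𝒜 →ₗ[k] TensorAlgebra k g.tot)
    (z : g.tot ⊗[k] augIdeal 𝒜) : TensorAlgebra.algebraMapInv (g.extend θ z) = 0 := by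
  induction z using TensorProduct.induction_on with
  | zero => simp
  | tmul q a => rw [extend_tmul, map_mul]; simp [TensorAlgebra.algebraMapInv]
  | add x y hx hy => rw [map_add, map_add, hx, hy, add_zero]

variable {g} (e : g.Embedding)

namespace Embedding

/-- `θ` splits the multiplication `T(Q) → A` and preserves the Adams grading. -/
theorem freeMul_θ_and_weightHom_θ (s : ℕ) : ∀ a ∈ augPart 𝒜 s,
    g.freeMul (e.θ a) = (a : A) ∧
      weightHom g.isInternal_genPart (e.θ a) = Polynomial.monomial s (e.θ a) := by
  induction s using Nat.strong_induction_on with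
  | _ s ih =>
    intro a ha
    rw [← g.Q_sup_D s] at ha
    obtain ⟨q, hq, x, hx, rfl⟩ := Submodule.mem_sup.1 ha
    have hQ := e.θ_gen ⟨q, g.Q_le_tot s hq⟩
    have hD := e.θ_dec ⟨x, hx.1⟩
    simp only at hQ hD
    have key : ∀ z ∈ g.QAPart s, g.freeMul (g.extend e.θ z) = ((g.QAMul z : augIdeal 𝒜) : A) ∧
        weightHom g.isInternal_genPart (g.extend e.θ z) =
          Polynomial.monomial s (g.extend e.θ z) := by
      intro z hz
      induction hz using Submodule.span_induction with
      | mem z h =>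
        obtain ⟨i, j, hij, q, hq, a, ha, rfl⟩ := h
        -- `Q₀ = 0`, so that `j < s` and the induction hypothesis applies to `a`
        rcases Nat.eq_zero_or_pos i with rfl | hi
        · rw [Q_zero, Submodule.mem_bot] at hq
          have : q = 0 := Subtype.ext hq
          subst this
          simp
        · obtain ⟨h1, h2⟩ := ih j (by omega) a ha
          rw [extend_tmul, QAMul_tmul, map_mul, map_mul, h1, h2, freeMul_ι,
            g.weightHom_gen hq, Polynomial.monomial_mul_monomial, hij]
          exact ⟨rfl, rfl⟩
      | zero => simp
      | add x y _ _ hx hy =>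
        simp only [map_add, hx.1, hx.2, hy.1, hy.2]
        exact ⟨rfl, trivial⟩
      | smul c x _ hx =>
        simp only [map_smul, hx.1, hx.2, Polynomial.smul_monomial]
        exact ⟨rfl, trivial⟩
    obtain ⟨h1, h2⟩ := key _ (e.ξ_mem s ⟨x, hx.1⟩ hx.2)
    rw [e.mul_ξ] at h1
    rw [map_add, hQ, hD]
    simp only [map_add, h1, h2, freeMul_ι, g.weightHom_gen (q := ⟨q, g.Q_le_tot s hq⟩) hq]
    exact ⟨rfl, trivial⟩

theorem freeMul_θ (a : augIdeal 𝒜) : g.freeMul (e.θ a) = (a : A) :=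
  augIdeal_le_of_augPart_le 𝒜 (S := LinearMap.eqLocus (g.freeMul.toLinearMap ∘ₗ e.θ)
    (augIdeal 𝒜).toSubmodule.subtype) (fun s a ha => (e.freeMul_θ_and_weightHom_θ s a ha).1) a

theorem weightHom_θ {s : ℕ} {a : augIdeal 𝒜} (ha : a ∈ augPart 𝒜 s) :
    weightHom g.isInternal_genPart (e.θ a) = Polynomial.monomial s (e.θ a) :=
  (e.freeMul_θ_and_weightHom_θ s a ha).2

theorem incl_tmul (q : g.tot) (a : augIdeal 𝒜) :
    e.incl (q ⊗ₜ[k] a) = TensorAlgebra.ι k q * e.θ a := g.extend_tmul _ q a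

theorem freeMul_incl (z : g.tot ⊗[k] augIdeal 𝒜) :
    g.freeMul (e.incl z) = ((g.QAMul z : augIdeal 𝒜) : A) := by
  induction z using TensorProduct.induction_on with
  | zero => simp
  | tmul q a => rw [incl_tmul, map_mul, freeMul_ι, freeMul_θ, QAMul_tmul]; rfl
  | add x y hx hy => rw [map_add, map_add, hx, hy, map_add]; rfl

theorem weightHom_incl {s : ℕ} {z : g.tot ⊗[k] augIdeal 𝒜} (hz : z ∈ g.QAPart s) :
    weightHom g.isInternal_genPart (e.incl z) = Polynomial.monomial s (e.incl z) := by
  induction hz using Submodule.span_induction with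
  | mem z h =>
    obtain ⟨i, j, hij, q, hq, a, ha, rfl⟩ := h
    rw [incl_tmul, map_mul, e.weightHom_θ ha,
      g.weightHom_gen hq, Polynomial.monomial_mul_monomial, hij]
  | zero => simp
  | add x y _ _ hx hy => simp only [map_add, hx, hy]
  | smul c x _ hx => simp only [map_smul, hx, Polynomial.smul_monomial]

theorem algebraMapInv_θ (a : augIdeal 𝒜) : TensorAlgebra.algebraMapInv (e.θ a) = 0 := by
  obtain ⟨q, x, rfl⟩ := g.exists_eq_add a
  rw [map_add, map_add, e.θ_gen, e.θ_dec, algebraMapInv_extend, add_zero]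
  simp [TensorAlgebra.algebraMapInv]

theorem incl_ξ (x : decomposables 𝒜) : e.incl (e.ξ x) = e.θ x := (e.θ_dec x).symm

variable {e} {R : ℕ → Submodule k (g.tot ⊗[k] augIdeal 𝒜)} (hR : e.IsMinimalRelations R)

include hR

theorem IsMinimalRelations.incl_mem {s : ℕ} {r : g.tot ⊗[k] augIdeal 𝒜} (hr : r ∈ R s) :
    e.incl r ∈ TwoSidedIdeal.ker g.freeMul := by
  rw [← hR.generates]
  exact TwoSidedIdeal.subset_span (Set.mem_iUnion.2 ⟨s, r, hr, rfl⟩)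

theorem IsMinimalRelations.QAMul_eq_zero {s : ℕ} {r : g.tot ⊗[k] augIdeal 𝒜} (hr : r ∈ R s) :
    g.QAMul r = 0 := by
  have h := hR.incl_mem hr
  rw [TwoSidedIdeal.mem_ker, freeMul_incl] at h
  exact Subtype.ext h

/-- By minimality, no nonzero element of `R_s` is decomposable: if `r ∈ R_s` lies in
`F₊ I + I F₊`, then a hyperplane of `R_s` not containing `r` generates the same ideal. -/
theorem IsMinimalRelations.eq_zero_of_incl_mem {s : ℕ} {r : g.tot ⊗[k] augIdeal 𝒜} (hr : r ∈ R s)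
    (h : e.incl r ∈ decomposableRelations (TwoSidedIdeal.ker g.freeMul)) : r = 0 := by
  by_contra hr0
  obtain ⟨φ, hφ⟩ := exists_dual_ne_zero (k := k) hr0
  -- replace `R_s` by the hyperplane `ker φ`, which does not contain `r`
  let R' : ℕ → Submodule k (g.tot ⊗[k] augIdeal 𝒜) :=
    Function.update R s (R s ⊓ LinearMap.ker φ)
  have hR'R : ∀ t, R' t ≤ R t := by
    intro t
    rcases eq_or_ne t s with rfl | ht
    · simp [R']
    · simp [R', ht]
  have hhom : ∀ (P : ℕ → Submodule k (g.tot ⊗[k] augIdeal 𝒜)), (∀ t, P t ≤ R t) →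
      ∀ x ∈ (⋃ s, e.incl '' (P s : Set (g.tot ⊗[k] augIdeal 𝒜))),
      ∃ t, weightHom g.isInternal_genPart x = Polynomial.monomial t x := by
    intro P hP x hx
    obtain ⟨t, z, hz, rfl⟩ := Set.mem_iUnion.1 hx
    exact ⟨t, e.weightHom_incl (hR.le t (hP t hz))⟩
  have hle : TwoSidedIdeal.span (⋃ s, e.incl '' (R s : Set (g.tot ⊗[k] augIdeal 𝒜))) ≤
      TwoSidedIdeal.span (⋃ s, e.incl '' (R' s : Set (g.tot ⊗[k] augIdeal 𝒜))) := by
    refine span_le_of_sub_mem_decomposableRelations g.isInternal_genPart g.genPart_zero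
      (hhom R fun _ => le_rfl)
      (fun x hx t => weightComp_mem_span g.isInternal_genPart _ (hhom R' hR'R) t hx) ?_
    rw [hR.generates]
    intro x hx
    obtain ⟨t, z, hz, rfl⟩ := Set.mem_iUnion.1 hx
    rcases eq_or_ne t s with rfl | ht
    · refine ⟨e.incl (z + (-(φ z / φ r)) • r), TwoSidedIdeal.subset_span
        (Set.mem_iUnion.2 ⟨t, _, ?_, rfl⟩), ?_⟩
      · simp only [R', Function.update_self]
        refine ⟨Submodule.add_mem _ hz (Submodule.smul_mem _ _ hr), ?_⟩
        simp [hφ]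
      · rw [map_add, map_smul, neg_smul, ← sub_eq_add_neg, sub_sub_cancel]
        exact Submodule.smul_mem _ _ h
    · refine ⟨e.incl z, TwoSidedIdeal.subset_span (Set.mem_iUnion.2 ⟨t, z, ?_, rfl⟩), ?_⟩
      · simpa [R', ht] using hz
      · rw [sub_self]
        exact Submodule.zero_mem _
  have heq : R' = R := by
    refine hR.minimal R' hR'R (le_antisymm ?_ (hR.generates ▸ hle))
    rw [← hR.generates]
    refine TwoSidedIdeal.span_mono (Set.iUnion_mono fun t => Set.image_mono (hR'R t))
  have : r ∈ R' s := by rw [heq]; exact hr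
  simp only [R', Function.update_self] at this
  exact hφ this.2

end Embedding

end Generators

/-! ### Cochains of degree one and two -/

section Cochains

variable {k A : Type*} [Field k] [Ring A] [Algebra k A]
variable {𝒜 : ℕ → Submodule k A} [GradedAlgebra 𝒜]

theorem barPart_apply_eq_zero {n s : ℕ} {f : barDual 𝒜} (hf : f ∈ barPart 𝒜 n s)
    {w : List (augIdeal 𝒜)} (hw : w.length ≠ n) : (f : WordFun k (augIdeal 𝒜)) w = 0 :=
  hf.2.1 w hw

theorem evalTwo_tmul (f : barDual 𝒜) (a b : augIdeal 𝒜) :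
    evalTwo f (a ⊗ₜ[k] b) = (f : WordFun k (augIdeal 𝒜)) [a, b] := by
  simp [evalTwo]

theorem evalOne_apply (f : barDual 𝒜) (a : augIdeal 𝒜) :
    evalOne f a = (f : WordFun k (augIdeal 𝒜)) [a] := rfl

theorem evalOne_add (f g : barDual 𝒜) : evalOne (f + g) = evalOne f + evalOne g := rfl

theorem evalOne_smul (c : k) (f : barDual 𝒜) : evalOne (c • f) = c • evalOne f := rfl

theorem evalTwo_add (f g : barDual 𝒜) : evalTwo (f + g) = evalTwo f + evalTwo g := by
  refine TensorProduct.ext' fun a b => ?_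
  simp only [LinearMap.add_apply, evalTwo_tmul]
  rfl

theorem evalTwo_smul (c : k) (f : barDual 𝒜) : evalTwo (c • f) = c • evalTwo f := by
  refine TensorProduct.ext' fun a b => ?_
  simp only [LinearMap.smul_apply, evalTwo_tmul]
  rfl

theorem evalTwo_zero : evalTwo (0 : barDual 𝒜) = 0 := by
  simpa using evalTwo_smul (0 : k) (0 : barDual 𝒜)

theorem barPart_one_ext {s : ℕ} {f g : barDual 𝒜} (hf : f ∈ barPart 𝒜 1 s)
    (hg : g ∈ barPart 𝒜 1 s) (h : ∀ a, evalOne f a = evalOne g a) : f = g := by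
  apply Subtype.ext
  ext w
  match w with
  | [a] => exact h a
  | [] => rw [barPart_apply_eq_zero hf (by simp), barPart_apply_eq_zero hg (by simp)]
  | a :: b :: w => rw [barPart_apply_eq_zero hf (by simp), barPart_apply_eq_zero hg (by simp)]

theorem barPart_two_ext {s : ℕ} {f g : barDual 𝒜} (hf : f ∈ barPart 𝒜 2 s)
    (hg : g ∈ barPart 𝒜 2 s) (h : ∀ a b, evalTwo f (a ⊗ₜ[k] b) = evalTwo g (a ⊗ₜ[k] b)) :
    f = g := by
  apply Subtype.ext
  ext w
  match w with
  | [a, b] => simpa [evalTwo_tmul] using h a b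
  | [] => rw [barPart_apply_eq_zero hf (by simp), barPart_apply_eq_zero hg (by simp)]
  | [a] => rw [barPart_apply_eq_zero hf (by simp), barPart_apply_eq_zero hg (by simp)]
  | a :: b :: c :: w => rw [barPart_apply_eq_zero hf (by simp), barPart_apply_eq_zero hg (by simp)]

theorem evalOne_eq_zero {s t : ℕ} (h : t ≠ s) {f : barDual 𝒜} (hf : f ∈ barPart 𝒜 1 s)
    {a : augIdeal 𝒜} (ha : a ∈ augPart 𝒜 t) : evalOne f a = 0 :=
  hf.2.2 [a] t ⟨[t], .cons ha .nil, by simp⟩ h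

theorem evalTwo_eq_zero {s i j : ℕ} (h : i + j ≠ s) {f : barDual 𝒜} (hf : f ∈ barPart 𝒜 2 s)
    {a b : augIdeal 𝒜} (ha : a ∈ augPart 𝒜 i) (hb : b ∈ augPart 𝒜 j) :
    evalTwo f (a ⊗ₜ[k] b) = 0 := by
  rw [evalTwo_tmul]
  exact hf.2.2 [a, b] (i + j) ⟨[i, j], .cons ha (.cons hb .nil), by simp⟩ h

/-- A functional on `𝔪` supported on `A_s` is a cochain of degree `1`. -/
theorem exists_cochain_one (s : ℕ) (φ : augIdeal 𝒜 →ₗ[k] k)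
    (h : ∀ t, t ≠ s → ∀ a ∈ augPart 𝒜 t, φ a = 0) :
    ∃ f ∈ barPart 𝒜 1 s, ∀ a, evalOne f a = φ a := by
  let f : WordFun k (augIdeal 𝒜) := ⟨fun w => match w with
    | [a] => φ a
    | _ => 0⟩
  have hf : f ∈ wordPart 𝒜 1 s := by
    refine ⟨fun u v a b c => ?_, fun w hw => ?_, fun w t hw ht => ?_⟩
    · match u, v with
      | [], [] => simp [f]
      | [], _ :: _ => simp [f]
      | [_], [] => simp [f]
      | [_], _ :: _ => simp [f]
      | _ :: _ :: _, _ => simp [f]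
    · match w with
      | [a] => simp at hw
      | [] => rfl
      | _ :: _ :: _ => rfl
    · obtain ⟨ds, hds, hs⟩ := hw
      match w, ds, hds with
      | [], _, _ => rfl
      | [a], [d], .cons ha _ =>
        have : d = t := by simpa using hs
        exact h t ht a (this ▸ ha)
      | _ :: _ :: _, _, _ => rfl
  exact ⟨⟨f, wordPart_le_barDual 𝒜 hf⟩, hf, fun a => rfl⟩

/-- A bilinear form on `𝔪` supported on `(𝔪 ⊗ 𝔪)_s` is a cochain of degree `2`. -/
theorem exists_cochain_two (s : ℕ) (β : augIdeal 𝒜 →ₗ[k] augIdeal 𝒜 →ₗ[k] k)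
    (h : ∀ i j, i + j ≠ s → ∀ a ∈ augPart 𝒜 i, ∀ b ∈ augPart 𝒜 j, β a b = 0) :
    ∃ f ∈ barPart 𝒜 2 s, ∀ a b, evalTwo f (a ⊗ₜ[k] b) = β a b := by
  let f : WordFun k (augIdeal 𝒜) := ⟨fun w => match w with
    | [a, b] => β a b
    | _ => 0⟩
  have hf : f ∈ wordPart 𝒜 2 s := by
    refine ⟨fun u v a b c => ?_, fun w hw => ?_, fun w t hw ht => ?_⟩
    · match u, v with
      | [], [] => simp [f]
      | [], [_] => simp [f]
      | [], _ :: _ :: _ => simp [f]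
      | [_], [] => simp [f]
      | [_], _ :: _ => simp [f]
      | [_, _], [] => simp [f]
      | [_, _], _ :: _ => simp [f]
      | _ :: _ :: _ :: _, _ => simp [f]
    · match w with
      | [a, b] => simp at hw
      | [] => rfl
      | [_] => rfl
      | _ :: _ :: _ :: _ => rfl
    · obtain ⟨ds, hds, hs⟩ := hw
      match w, ds, hds with
      | [], _, _ => rfl
      | [a], _, _ => rfl
      | [a, b], [d, d'], .cons ha (.cons hb _) =>
        have : d + d' = t := by simpa using hs
        exact h d d' (this ▸ ht) a ha b hb
      | _ :: _ :: _ :: _, _, _ => rfl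
  exact ⟨⟨f, wordPart_le_barDual 𝒜 hf⟩, hf, fun a b => evalTwo_tmul _ a b⟩

theorem coe_barDiff (f : barDual 𝒜) :
    ((barDiff 𝒜 f : barDual 𝒜) : WordFun k (augIdeal 𝒜)) = wordDiff (f : WordFun k (augIdeal 𝒜)) :=
  rfl

theorem barDiff_mem {n s : ℕ} {f : barDual 𝒜} (hf : f ∈ barPart 𝒜 n s) :
    barDiff 𝒜 f ∈ barPart 𝒜 (n + 1) s := wordDiff_mem 𝒜 hf

theorem evalOne_barDiff (f : barDual 𝒜) (a : augIdeal 𝒜) : evalOne (barDiff 𝒜 f) a = 0 := by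
  rw [evalOne_apply, coe_barDiff, wordDiff_apply]
  simp

theorem evalTwo_barDiff_tmul (f : barDual 𝒜) (a b : augIdeal 𝒜) :
    evalTwo (barDiff 𝒜 f) (a ⊗ₜ[k] b) = - evalOne f (a * b) := by
  rw [evalTwo_tmul, coe_barDiff, wordDiff_apply]
  simp [contract, evalOne_apply]

theorem evalTwo_barDiff_QAIncl (g : Generators 𝒜) (f : barDual 𝒜)
    (z : g.tot ⊗[k] augIdeal 𝒜) :
    evalTwo (barDiff 𝒜 f) (g.QAIncl z) = - evalOne f (g.QAMul z) := by
  induction z using TensorProduct.induction_on with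
  | zero => simp
  | tmul q a => rw [g.QAIncl_tmul, g.QAMul_tmul, evalTwo_barDiff_tmul]
  | add x y hx hy => simp only [map_add, hx, hy, neg_add]

theorem barDiff_eq_zero_iff_one {s : ℕ} {f : barDual 𝒜} (hf : f ∈ barPart 𝒜 1 s) :
    barDiff 𝒜 f = 0 ↔ ∀ x ∈ decomposables 𝒜, evalOne f x = 0 := by
  constructor
  · intro h x hx
    suffices H : decomposables 𝒜 ≤ LinearMap.ker (evalOne f) from H hx
    refine Submodule.span_le.2 ?_
    rintro _ ⟨a, b, rfl⟩
    have := evalTwo_barDiff_tmul f a b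
    rw [h, evalTwo_zero, LinearMap.zero_apply, eq_comm, neg_eq_zero] at this
    exact this
  · intro h
    refine barPart_two_ext (s := s) (barDiff_mem hf) (Submodule.zero_mem _) fun a b => ?_
    rw [evalTwo_barDiff_tmul, h _ (mul_mem_decomposables 𝒜 a b), neg_zero, evalTwo_zero]
    rfl

theorem barDiff_eq_zero_iff_two {s : ℕ} {f : barDual 𝒜} (hf : f ∈ barPart 𝒜 2 s) :
    barDiff 𝒜 f = 0 ↔
      ∀ a b c, evalTwo f ((a * b) ⊗ₜ[k] c) = evalTwo f (a ⊗ₜ[k] (b * c)) := by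
  have key : ∀ a b c, ((barDiff 𝒜 f : barDual 𝒜) : WordFun k (augIdeal 𝒜)) [a, b, c] =
      evalTwo f ((a * b) ⊗ₜ[k] c) - evalTwo f (a ⊗ₜ[k] (b * c)) := by
    intro a b c
    rw [coe_barDiff, wordDiff_apply, evalTwo_tmul, evalTwo_tmul]
    simp [contract, Finset.sum_range_succ]
    ring
  constructor
  · intro h a b c
    have := key a b c
    rw [h] at this
    exact (sub_eq_zero.1 this.symm)
  · intro h
    apply Subtype.ext
    ext w
    by_cases hw : w.length = 3
    · match w, hw with
      | [a, b, c], _ =>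
        rw [key, h, sub_self]
        rfl
    · rw [barPart_apply_eq_zero (barDiff_mem hf) hw]
      rfl

theorem evalTwo_QAIncl_eq_zero (g : Generators 𝒜) {s t : ℕ} (h : t ≠ s) {f : barDual 𝒜}
    (hf : f ∈ barPart 𝒜 2 s) {z : g.tot ⊗[k] augIdeal 𝒜} (hz : z ∈ g.QAPart t) :
    evalTwo f (g.QAIncl z) = 0 := by
  induction hz using Submodule.span_induction with
  | mem z hz =>
    obtain ⟨i, j, hij, q, hq, a, ha, rfl⟩ := hz
    rw [g.QAIncl_tmul]
    exact evalTwo_eq_zero (by omega) hf (g.Q_le_augPart i hq) ha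
  | zero => simp
  | add x y _ _ hx hy => rw [map_add, map_add, hx, hy, add_zero]
  | smul c x _ hx => rw [map_smul, map_smul, hx, smul_zero]

end Cochains

/-! ### Two-cocycles and relations -/

section Cocycles

variable {k A : Type*} [Field k] [Ring A] [Algebra k A]
variable {𝒜 : ℕ → Submodule k A} [GradedAlgebra 𝒜] (g : Generators 𝒜)

theorem Generators.projZero_freeMul (y : TensorAlgebra k g.tot) :
    GradedRing.projZeroRingHom 𝒜 (g.freeMul y) =
      algebraMap k A (TensorAlgebra.algebraMapInv y) := by
  induction y using TensorAlgebra.induction with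
  | algebraMap r =>
    rw [AlgHom.commutes, TensorAlgebra.algebraMap_leftInverse, GradedRing.projZeroRingHom_apply,
      DirectSum.decompose_of_mem_same 𝒜 (SetLike.algebraMap_mem_graded 𝒜 r)]
  | ι q =>
    rw [g.freeMul_ι, (q : augIdeal 𝒜).2]
    simp [TensorAlgebra.algebraMapInv]
  | mul a b ha hb => simp only [map_mul, ha, hb]
  | add a b ha hb => simp only [map_add, ha, hb]

/-- The map `T(Q) → A → 𝔪`, `y ↦ π(y) - ε(y)`, where `π` is the multiplication and `ε` the
augmentation. -/
def Generators.freePlus : TensorAlgebra k g.tot →ₗ[k] augIdeal 𝒜 where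
  toFun y := ⟨g.freeMul y - algebraMap k A (TensorAlgebra.algebraMapInv y), by
    rw [mem_augIdeal, map_sub, g.projZero_freeMul, GradedRing.projZeroRingHom_apply,
      DirectSum.decompose_of_mem_same 𝒜 (SetLike.algebraMap_mem_graded 𝒜 _), sub_self]⟩
  map_add' x y := Subtype.ext (by
    change _ = (_ - _) + (_ - _)
    simp only [map_add]
    abel)
  map_smul' c x := Subtype.ext (by
    change _ = c • (_ - _)
    change g.freeMul (c • x) - algebraMap k A (TensorAlgebra.algebraMapInv (c • x)) = _
    rw [map_smul, map_smul, smul_eq_mul, map_mul, smul_sub, ← Algebra.smul_def])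

theorem Generators.coe_freePlus (y : TensorAlgebra k g.tot) :
    (g.freePlus y : A) = g.freeMul y - algebraMap k A (TensorAlgebra.algebraMapInv y) := rfl

theorem Generators.freePlus_mul (x y : TensorAlgebra k g.tot) :
    g.freePlus (x * y) = g.freePlus x * g.freePlus y +
      (TensorAlgebra.algebraMapInv x : k) • g.freePlus y +
      (TensorAlgebra.algebraMapInv y : k) • g.freePlus x := by
  apply Subtype.ext
  change g.freeMul (x * y) - _ = (g.freePlus x : A) * (g.freePlus y : A) +
      (TensorAlgebra.algebraMapInv x : k) • (g.freePlus y : A) +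
      (TensorAlgebra.algebraMapInv y : k) • (g.freePlus x : A)
  simp only [g.coe_freePlus, map_mul, Algebra.smul_def]
  have h := Algebra.commutes (A := A) (TensorAlgebra.algebraMapInv y : k) (g.freeMul x)
  have h' := Algebra.commutes (A := A) (TensorAlgebra.algebraMapInv y : k)
    (algebraMap k A (TensorAlgebra.algebraMapInv x))
  simp only [mul_sub, sub_mul, h, h']
  abel

theorem Generators.freePlus_ι (q : g.tot) : g.freePlus (TensorAlgebra.ι k q) = q := by
  apply Subtype.ext
  rw [g.coe_freePlus, g.freeMul_ι]
  simp [TensorAlgebra.algebraMapInv]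

theorem Generators.algebraMapInv_of_mem_ker [Nontrivial A] {x : TensorAlgebra k g.tot}
    (hx : x ∈ TwoSidedIdeal.ker g.freeMul) : TensorAlgebra.algebraMapInv x = 0 := by
  have h := g.projZero_freeMul x
  rw [(TwoSidedIdeal.mem_ker _).1 hx, map_zero, eq_comm] at h
  exact (map_eq_zero_iff _ (algebraMap k A).injective).1 h

theorem Generators.freePlus_of_mem_ker [Nontrivial A] {x : TensorAlgebra k g.tot}
    (hx : x ∈ TwoSidedIdeal.ker g.freeMul) : g.freePlus x = 0 := by
  apply Subtype.ext
  rw [g.coe_freePlus, g.algebraMapInv_of_mem_ker hx, (TwoSidedIdeal.mem_ker _).1 hx]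
  simp

/-- For a bilinear form `f` on `𝔪`, the functional `Ψ` on `T(Q)` with `Ψ(1) = 0` and
`Ψ(q · y) = f(q, π(y) - ε(y))` for `q ∈ Q`. -/
def Generators.cocycleLift (f : barDual 𝒜) : TensorAlgebra k g.tot →ₗ[k] k :=
  leftRec (LinearMap.mk₂ k (fun (q : g.tot) (y : TensorAlgebra k g.tot) =>
      evalTwo f ((q : augIdeal 𝒜) ⊗ₜ[k] g.freePlus y))
    (fun q q' y => by simp [TensorProduct.add_tmul])
    (fun c q y => by simp [← TensorProduct.smul_tmul'])
    (fun q y y' => by simp [TensorProduct.tmul_add])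
    (fun c q y => by simp))

theorem Generators.cocycleLift_one (f : barDual 𝒜) : g.cocycleLift f 1 = 0 := leftRec_one _

theorem Generators.cocycleLift_ι_mul (f : barDual 𝒜) (q : g.tot) (y : TensorAlgebra k g.tot) :
    g.cocycleLift f (TensorAlgebra.ι k q * y) =
      evalTwo f ((q : augIdeal 𝒜) ⊗ₜ[k] g.freePlus y) :=
  leftRec_ι_mul _ q y

/-- For a cocycle `f`, the coboundary of the functional `Ψ` is the pullback of `f` to `T(Q)`. -/
theorem Generators.cocycleLift_mul {f : barDual 𝒜}
    (hf : ∀ a b c, evalTwo f ((a * b) ⊗ₜ[k] c) = evalTwo f (a ⊗ₜ[k] (b * c)))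
    (y x : TensorAlgebra k g.tot) :
    g.cocycleLift f (y * x) = evalTwo f (g.freePlus y ⊗ₜ[k] g.freePlus x) +
      TensorAlgebra.algebraMapInv y * g.cocycleLift f x +
      TensorAlgebra.algebraMapInv x * g.cocycleLift f y := by
  let S : Submodule k (TensorAlgebra k g.tot) :=
    LinearMap.eqLocus (g.cocycleLift f ∘ₗ LinearMap.mulRight k x)
      (evalTwo f ∘ₗ (TensorProduct.mk k (augIdeal 𝒜) (augIdeal 𝒜)).flip (g.freePlus x) ∘ₗ
          g.freePlus +
        g.cocycleLift f x • (TensorAlgebra.algebraMapInv (R := k) (M := g.tot)).toLinearMap +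
        (TensorAlgebra.algebraMapInv x : k) • g.cocycleLift f)
  have hS : ∀ y, y ∈ S ↔ g.cocycleLift f (y * x) =
      evalTwo f (g.freePlus y ⊗ₜ[k] g.freePlus x) +
      TensorAlgebra.algebraMapInv y * g.cocycleLift f x +
      TensorAlgebra.algebraMapInv x * g.cocycleLift f y := by
    intro y
    rw [LinearMap.mem_eqLocus]
    simp [mul_comm (g.cocycleLift f x)]
  have htop : S = ⊤ := by
    refine tensorAlgebra_left_induction S ?_ fun q y _ => ?_
    · have h1 : g.freePlus 1 = 0 := Subtype.ext (by rw [g.coe_freePlus]; simp)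
      rw [hS, g.cocycleLift_one, one_mul, h1, map_one]
      simp
    · have hε : TensorAlgebra.algebraMapInv (TensorAlgebra.ι k q) = 0 := by
        simp [TensorAlgebra.algebraMapInv]
      rw [hS, mul_assoc, g.cocycleLift_ι_mul, g.cocycleLift_ι_mul, g.freePlus_mul, g.freePlus_mul,
        map_mul, hε, g.freePlus_ι]
      simp only [TensorProduct.tmul_add, TensorProduct.add_tmul, map_add, zero_smul, zero_mul,
        TensorProduct.tmul_smul, ← TensorProduct.smul_tmul', map_smul, hf, smul_eq_mul,
        TensorProduct.zero_tmul, map_zero]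
      ring
  rw [← hS, htop]
  trivial

variable {g} {e : g.Embedding} {R : ℕ → Submodule k (g.tot ⊗[k] augIdeal 𝒜)}

theorem Generators.Embedding.freePlus_θ (e : g.Embedding) (a : augIdeal 𝒜) :
    g.freePlus (e.θ a) = a := by
  apply Subtype.ext
  rw [g.coe_freePlus, e.algebraMapInv_θ, e.freeMul_θ, map_zero, sub_zero]

theorem Generators.Embedding.cocycleLift_incl (e : g.Embedding) (f : barDual 𝒜)
    (z : g.tot ⊗[k] augIdeal 𝒜) : g.cocycleLift f (e.incl z) = evalTwo f (g.QAIncl z) := by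
  induction z using TensorProduct.induction_on with
  | zero => simp
  | tmul q a => rw [e.incl_tmul, g.cocycleLift_ι_mul, e.freePlus_θ, g.QAIncl_tmul]
  | add x y hx hy => simp only [map_add, hx, hy]

/-- The failure of `θ` to be multiplicative, `(a, b) ↦ θ(a) θ(b) - θ(ab)`. -/
def Generators.Embedding.curvature (e : g.Embedding) :
    augIdeal 𝒜 →ₗ[k] augIdeal 𝒜 →ₗ[k] TensorAlgebra k g.tot :=
  LinearMap.mk₂ k (fun a b : augIdeal 𝒜 => e.θ a * e.θ b - e.θ (a * b))
    (fun a a' b => by rw [map_add, add_mul, add_mul, map_add, add_sub_add_comm])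
    (fun r a b => by rw [map_smul, smul_mul_assoc, smul_mul_assoc, map_smul, smul_sub])
    (fun a b b' => by rw [map_add, mul_add, mul_add, map_add, add_sub_add_comm])
    (fun r a b => by rw [map_smul, mul_smul_comm, mul_smul_comm, map_smul, smul_sub])

theorem Generators.Embedding.θ_mul_sub_mem_ker (e : g.Embedding) (a b : augIdeal 𝒜) :
    e.θ a * e.θ b - e.θ (a * b) ∈ TwoSidedIdeal.ker g.freeMul := by
  rw [TwoSidedIdeal.mem_ker, map_sub, map_mul, e.freeMul_θ, e.freeMul_θ, e.freeMul_θ]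
  exact sub_self _

/-- A `2`-cocycle that vanishes on `R` and on `ξ(D)` is zero. -/
theorem Generators.Embedding.IsMinimalRelations.evalTwo_eq_zero [Nontrivial A]
    (hR : e.IsMinimalRelations R) {f : barDual 𝒜}
    (hf : ∀ a b c, evalTwo f ((a * b) ⊗ₜ[k] c) = evalTwo f (a ⊗ₜ[k] (b * c)))
    (hfR : ∀ s, ∀ r ∈ R s, evalTwo f (g.QAIncl r) = 0)
    (hfξ : ∀ x : decomposables 𝒜, evalTwo f (g.QAIncl (e.ξ x)) = 0) (a b : augIdeal 𝒜) :
    evalTwo f (a ⊗ₜ[k] b) = 0 := by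
  have hker : ∀ x ∈ TwoSidedIdeal.ker g.freeMul, g.cocycleLift f x = 0 := by
    intro x hx
    rw [← hR.generates] at hx
    induction hx using TwoSidedIdeal.span_induction with
    | mem x h =>
      obtain ⟨s, r, hr, rfl⟩ := Set.mem_iUnion.1 h
      rw [e.cocycleLift_incl, hfR s r hr]
    | zero => simp
    | add x y _ _ hx hy => rw [map_add, hx, hy, add_zero]
    | neg x _ hx => rw [map_neg, hx, neg_zero]
    | left_absorb a x h hx =>
      rw [hR.generates] at h
      rw [g.cocycleLift_mul hf, hx, g.freePlus_of_mem_ker h, g.algebraMapInv_of_mem_ker h]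
      simp
    | right_absorb a x h hx =>
      rw [hR.generates] at h
      rw [g.cocycleLift_mul hf, hx, g.freePlus_of_mem_ker h, g.algebraMapInv_of_mem_ker h]
      simp
  have h := hker _ (e.θ_mul_sub_mem_ker a b)
  rw [map_sub, g.cocycleLift_mul hf, e.freePlus_θ, e.freePlus_θ, e.algebraMapInv_θ,
    e.algebraMapInv_θ, show e.θ (a * b) = e.incl (e.ξ ⟨a * b, mul_mem_decomposables 𝒜 a b⟩) from
      e.θ_dec ⟨a * b, mul_mem_decomposables 𝒜 a b⟩, e.cocycleLift_incl, hfξ] at h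
  simpa using h

/-- Every functional on `R_s` extends to a `2`-cocycle that vanishes on `ξ(D)`.  It is
`f(a, b) = χ(θ(a) θ(b) - θ(ab))` for a functional `χ` on `T(Q)` that vanishes on `F₊ I + I F₊`. -/
theorem Generators.Embedding.IsMinimalRelations.exists_cocycle
    (hR : e.IsMinimalRelations R) (s : ℕ) (φ : Module.Dual k (R s)) :
    ∃ f ∈ barPart 𝒜 2 s, barDiff 𝒜 f = 0 ∧
      (∀ r : R s, evalTwo f (g.QAIncl r) = φ r) ∧
      ∀ x : decomposables 𝒜, evalTwo f (g.QAIncl (e.ξ x)) = 0 := by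
  set I := TwoSidedIdeal.ker g.freeMul with hI
  set c := weightComp g.isInternal_genPart s with hc
  obtain ⟨ρ, hρ, hρ0⟩ := exists_leftInverse_vanishing (e.incl ∘ₗ (R s).subtype)
    (decomposableRelations I) (fun r hr => Subtype.ext (hR.eq_zero_of_incl_mem r.2 hr))
  have hIw : ∀ x ∈ I, ∀ t, weightComp g.isInternal_genPart t x ∈ I := by
    intro x hx t
    rw [hI, ← hR.generates] at hx ⊢
    refine weightComp_mem_span _ _ (fun x hx => ?_) t hx
    obtain ⟨t, z, hz, rfl⟩ := Set.mem_iUnion.1 hx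
    exact ⟨t, e.weightHom_incl (hR.le t hz)⟩
  set χ : TensorAlgebra k g.tot →ₗ[k] k := φ ∘ₗ ρ ∘ₗ c with hχdef
  have hχ : ∀ z ∈ decomposableRelations I, χ z = 0 := by
    intro z hz
    rw [hχdef, LinearMap.comp_apply, LinearMap.comp_apply, hρ0 _ (weightComp_mem_decomposableRelations _ g.genPart_zero hIw hz s), map_zero]
  have hβ : ∀ a b, e.curvature.compr₂ χ a b =
      χ (e.θ a * e.θ b - e.θ (a * b)) := fun a b => rfl
  obtain ⟨f, hf, hfe⟩ := exists_cochain_two s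
    (e.curvature.compr₂ χ)
    (by
      intro i j hij a ha b hb
      rw [hβ, hχdef, LinearMap.comp_apply, LinearMap.comp_apply, hc, weightComp_of_homogeneous (t := i + j), if_neg hij]
      · simp
      · rw [map_sub, map_mul, e.weightHom_θ ha, e.weightHom_θ hb,
          e.weightHom_θ (mul_mem_augPart 𝒜 ha hb), Polynomial.monomial_mul_monomial, map_sub])
  have hfQ : ∀ z, evalTwo f (g.QAIncl z) = χ (e.incl z - e.θ (g.QAMul z)) := by
    intro z
    induction z using TensorProduct.induction_on with
    | zero => simp
    | tmul q a =>
      rw [g.QAIncl_tmul, hfe, hβ, e.θ_gen, e.incl_tmul, g.QAMul_tmul]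
    | add x y hx hy =>
      rw [map_add, map_add, hx, hy, ← map_add, map_add e.incl,
        map_add g.QAMul, map_add e.θ, add_sub_add_comm]
  refine ⟨f, hf, ?_, fun r => ?_, fun x => ?_⟩
  · rw [barDiff_eq_zero_iff_two hf]
    intro x y z
    rw [hfe, hfe, hβ, hβ, ← sub_eq_zero, ← map_sub]
    have hε := e.algebraMapInv_θ
    have key : e.θ (x * y) * e.θ z - e.θ (x * y * z) - (e.θ x * e.θ (y * z) - e.θ (x * (y * z))) =
        e.θ x * (e.θ y * e.θ z - e.θ (y * z)) - (e.θ x * e.θ y - e.θ (x * y)) * e.θ z := by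
      rw [mul_assoc x y z]
      noncomm_ring
    rw [key]
    exact hχ _ (Submodule.sub_mem _
      (Submodule.subset_span ⟨_, e.θ_mul_sub_mem_ker y z, _, hε x, .inl rfl⟩)
      (Submodule.subset_span ⟨_, e.θ_mul_sub_mem_ker x y, _, hε z, .inr rfl⟩))
  · rw [hfQ, hR.QAMul_eq_zero r.2, map_zero, sub_zero, hχdef, LinearMap.comp_apply,
      LinearMap.comp_apply, hc,
      weightComp_of_homogeneous _ (e.weightHom_incl (hR.le s r.2)), if_pos rfl]
    exact congrArg φ (hρ r)
  · rw [hfQ, e.incl_ξ, e.mul_ξ, sub_self, map_zero]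

end Cocycles

/-! ### The differential squares to zero -/

section DifferentialSquared

variable {k M : Type*} [Field k]

theorem contract_ne_nil [Mul M] (j : ℕ) {w : List M} (hw : w ≠ []) : contract j w ≠ [] := by
  match j, w with
  | _, [] => exact absurd rfl hw
  | _, [a] => simp [contract]
  | 0, a :: b :: w => simp [contract]
  | j + 1, a :: b :: w => simp [contract]

theorem contract_succ_cons [Mul M] (j : ℕ) (a : M) {w : List M} (hw : w ≠ []) :
    contract (j + 1) (a :: w) = a :: contract j w := by
  match w with
  | [] => exact absurd rfl hw
  | b :: w => rfl

theorem contract_contract [Semigroup M] (i j : ℕ) (hij : i ≤ j) (w : List M) :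
    contract i (contract (j + 1) w) = contract j (contract i w) := by
  induction i generalizing j w with
  | zero =>
    match j, w with
    | _, [] => simp [contract]
    | _, [a] => simp [contract]
    | 0, [a, b] => simp [contract]
    | j + 1, [a, b] => simp [contract]
    | 0, a :: b :: c :: w => simp [contract, mul_assoc]
    | j + 1, a :: b :: c :: w => simp [contract]
  | succ i ih =>
    obtain ⟨j, rfl⟩ : ∃ j', j = j' + 1 := ⟨j - 1, by omega⟩
    match w with
    | [] => simp [contract]
    | [a] => simp [contract]
    | a :: b :: w =>
      have h : b :: w ≠ [] := by simp
      rw [contract_succ_cons _ a h, contract_succ_cons _ a h,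
        contract_succ_cons _ a (contract_ne_nil _ h), contract_succ_cons _ a (contract_ne_nil _ h),
        ih j (by omega)]

/-- The terms `(i, j + 1)` and `(j, i)` with `i ≤ j` cancel. -/
theorem sum_alternating_eq_zero (m : ℕ) (F : ℕ → ℕ → k)
    (hF : ∀ i j, i ≤ j → F i (j + 1) = F j i) :
    ∑ j ∈ Finset.range (m + 1), ∑ i ∈ Finset.range m, (-1 : k) ^ (i + j) * F i j = 0 := by
  rw [← Finset.sum_product']
  refine Finset.sum_involution
    (fun x _ => if x.2 < x.1 then (x.2, x.1 - 1) else (x.2 + 1, x.1)) ?_ ?_ ?_ ?_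
  · rintro ⟨j, i⟩ -
    simp only
    split_ifs with h
    · obtain ⟨l, rfl⟩ : ∃ l, j = l + 1 := ⟨j - 1, by omega⟩
      simp only [Nat.add_sub_cancel]
      rw [hF i l (by omega), add_comm l i, ← add_assoc, pow_succ]
      ring
    · simp only
      rw [hF j i (by omega), add_comm j (i + 1), add_right_comm, pow_succ]
      ring
  · rintro ⟨j, i⟩ - -
    simp only
    split_ifs with h
    · intro h'
      simp only [Prod.mk.injEq] at h'
      omega
    · intro h'
      simp only [Prod.mk.injEq] at h'
      omega
  · rintro ⟨j, i⟩ hx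
    simp only [Finset.mem_product, Finset.mem_range] at hx ⊢
    split_ifs with h <;> simp only <;> omega
  · rintro ⟨j, i⟩ -
    by_cases h : i < j
    · have h1 : ¬ (j - 1 < i) := by omega
      simp only [h, if_true, h1, if_false]
      congr 1
      omega
    · have h1 : j < i + 1 := by omega
      simp [h, h1]

theorem wordDiff_wordDiff [Semigroup M] (f : WordFun k M) : wordDiff (wordDiff f) = 0 := by
  ext w
  rw [wordDiff_apply, WordFun.zero_apply]
  rcases Nat.lt_or_ge w.length 2 with hw | hw
  · have : w.length - 1 = 0 := by omega
    simp [this]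
  · obtain ⟨m, hm⟩ : ∃ m, w.length = m + 2 := ⟨w.length - 2, by omega⟩
    have h := sum_alternating_eq_zero m (fun i j => f (contract i (contract j w)))
      (fun i j hij => by rw [contract_contract i j hij])
    have e : ∀ j ∈ Finset.range (w.length - 1), (-1 : k) ^ (j + 1) * wordDiff f (contract j w) =
        (-1 : k) ^ (m + 1) *
          ∑ i ∈ Finset.range m, (-1 : k) ^ (i + j) * f (contract i (contract j w)) := by
      intro j hj
      have hl := length_contract j w (by have := Finset.mem_range.1 hj; omega)
      have hl' : (contract j w).length = m + 1 := by omega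
      rw [wordDiff_apply, hl', Nat.add_sub_cancel, Finset.mul_sum, Finset.mul_sum, Finset.mul_sum]
      refine Finset.sum_congr rfl fun i _ => ?_
      ring
    rw [Finset.sum_congr rfl e, ← Finset.mul_sum, hm, show m + 2 - 1 = m + 1 from rfl, h]
    simp

end DifferentialSquared

/-! ### The bigrading of the bar construction -/

section Bigrading

variable {k A : Type*} [Field k] [Ring A] [Algebra k A]
variable {𝒜 : ℕ → Submodule k A} [GradedAlgebra 𝒜]

theorem barDiff_barDiff (f : barDual 𝒜) : barDiff 𝒜 (barDiff 𝒜 f) = 0 :=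
  Subtype.ext (wordDiff_wordDiff (f : WordFun k (augIdeal 𝒜)))

/-- A multilinear function is determined by its values on homogeneous words. -/
theorem isMultilinear_eq_zero {f : WordFun k (augIdeal 𝒜)} (hf : f.IsMultilinear)
    (h : ∀ w t, IsHomWord 𝒜 w t → f w = 0) (w : List (augIdeal 𝒜)) : f w = 0 := by
  induction w generalizing f with
  | nil => exact h [] 0 ⟨[], .nil, rfl⟩
  | cons a w ih =>
    have h0 : f (0 :: w) = 0 := by simpa using hf [] w 0 0 1
    let S : Submodule k (augIdeal 𝒜) :=
      { carrier := {a | f (a :: w) = 0}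
        add_mem' := fun {a b} ha hb => by
          have := hf [] w a b 1
          simp only [Set.mem_ofPred_eq] at ha hb ⊢
          simpa [ha, hb] using this
        zero_mem' := h0
        smul_mem' := fun c a ha => by
          have := hf [] w 0 a c
          simp only [Set.mem_ofPred_eq] at ha ⊢
          simpa [ha, h0] using this }
    refine augIdeal_le_of_augPart_le 𝒜 (S := S) (fun s a ha => ?_) a
    exact ih (f := ⟨fun w => f (a :: w)⟩) (fun u v b c r => hf (a :: u) v b c r)
      fun w t ⟨ds, hds, _⟩ => h (a :: w) (s + ds.sum) ⟨s :: ds, .cons ha hds, by simp⟩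

/-- `B^# A` is the direct sum of its bihomogeneous components. -/
theorem isInternal_barPart : DirectSum.IsInternal (fun i : ℕ × ℕ => barPart 𝒜 i.1 i.2) := by
  refine DirectSum.isInternal_submodule_of_iSupIndep_of_iSup_eq_top ?_ ?_
  · rintro ⟨n, s⟩
    rw [Submodule.disjoint_def]
    intro f hf hf'
    let ev (w : List (augIdeal 𝒜)) : barDual 𝒜 →ₗ[k] k :=
      { toFun := fun g => (g : WordFun k (augIdeal 𝒜)) w
        map_add' := fun _ _ => rfl
        map_smul' := fun _ _ => rfl }
    apply Subtype.ext
    ext w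
    refine isMultilinear_eq_zero hf.1 (fun w t hw => ?_) w
    by_cases hl : w.length = n
    · by_cases hts : t = s
      · subst hl hts
        have hle : (⨆ j : ℕ × ℕ, ⨆ (_ : j ≠ (w.length, t)), barPart 𝒜 j.1 j.2) ≤
            LinearMap.ker (ev w) := by
          refine iSup₂_le fun j hj g hg => ?_
          by_cases h1 : w.length = j.1
          · exact hg.2.2 w t hw fun h2 => hj (Prod.ext h1.symm h2.symm)
          · exact hg.2.1 w h1
        exact hle hf'
      · exact hf.2.2 w t hw hts
    · exact hf.2.1 w hl
  · refine (Submodule.eq_top_iff').2 fun f => ?_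
    have h : (⨆ (n : ℕ) (s : ℕ), wordPart 𝒜 n s) ≤
        (⨆ i : ℕ × ℕ, barPart 𝒜 i.1 i.2).map
          (Subalgebra.toSubmodule (barDual 𝒜)).subtype := by
      refine iSup₂_le fun n s g hg => ?_
      exact ⟨⟨g, wordPart_le_barDual 𝒜 hg⟩,
        Submodule.mem_iSup_of_mem (p := fun i : ℕ × ℕ => barPart 𝒜 i.1 i.2) (n, s) hg, rfl⟩
    obtain ⟨g, hg, hgf⟩ := h f.2
    rwa [show g = f from Subtype.ext hgf] at hg

end Bigrading

/-! ### Existence of Merkulov data -/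

section Existence

variable {k T : Type*} [Field k] [Ring T] [Algebra k T]

theorem exists_linearMap_of_isInternal {ι : Type*} [DecidableEq ι] {W : ι → Submodule k T}
    (hW : DirectSum.IsInternal W) (u : ι → T →ₗ[k] T) :
    ∃ U : T →ₗ[k] T, ∀ i, ∀ x ∈ W i, U x = u i x := by
  refine ⟨DirectSum.toModule k ι T (fun i => u i ∘ₗ (W i).subtype) ∘ₗ
      (LinearEquiv.ofBijective (DirectSum.coeLinearMap W) hW).symm.toLinearMap, fun i x hx => ?_⟩
  have h : (LinearEquiv.ofBijective (DirectSum.coeLinearMap W) hW).symm x =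
      DirectSum.lof k ι (fun t => W t) i ⟨x, hx⟩ := by
    rw [LinearEquiv.symm_apply_eq]
    exact (DirectSum.coeLinearMap_lof W i ⟨x, hx⟩).symm
  simp [h]

theorem exists_relative_compl {B Z : Submodule k T} (h : B ≤ Z) :
    ∃ H, Disjoint B H ∧ B ⊔ H = Z := by
  obtain ⟨C, hC⟩ := Submodule.exists_isCompl B
  refine ⟨C ⊓ Z, hC.disjoint.mono_right inf_le_left, ?_⟩
  rw [← sup_inf_assoc_of_le C h, hC.sup_eq_top, top_inf_eq]

/-- A decomposition into coboundaries, `H` and `L` in each bidegree determines `p` and `G`. -/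
theorem exists_merkulovData {𝒯 : ℕ → ℕ → Submodule k T} {d : T →ₗ[k] T}
    (hint : DirectSum.IsInternal (fun i : ℕ × ℕ => 𝒯 i.1 i.2))
    (hd : ∀ n s, ∀ x ∈ 𝒯 n s, d x ∈ 𝒯 (n + 1) s)
    (H L : ℕ → ℕ → Submodule k T)
    (hBH : ∀ n s, Disjoint (𝒯 n s ⊓ LinearMap.range d) (H n s))
    (hZ : ∀ n s, (𝒯 n s ⊓ LinearMap.range d) ⊔ H n s = 𝒯 n s ⊓ LinearMap.ker d)
    (hZL : ∀ n s, Disjoint (𝒯 n s ⊓ LinearMap.ker d) (L n s))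
    (hT : ∀ n s, (𝒯 n s ⊓ LinearMap.ker d) ⊔ L n s = 𝒯 n s) :
    ∃ M : MerkulovData 𝒯 d, M.H = H ∧ M.L = L := by
  have hLT : ∀ n s, L n s ≤ 𝒯 n s := fun n s => by rw [← hT n s]; exact le_sup_right
  have hHZ : ∀ n s, H n s ≤ 𝒯 n s ⊓ LinearMap.ker d := fun n s => by
    rw [← hZ n s]; exact le_sup_right
  have hBT : ∀ n s, 𝒯 n s ⊓ LinearMap.range d ≤ 𝒯 n s ⊓ LinearMap.ker d := fun n s => by
    rw [← hZ n s]; exact le_sup_left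
  -- a cocycle in a sum involving `L` has no component in `L`
  have hsplit : ∀ n s (P : Submodule k T), P ≤ 𝒯 n s ⊓ LinearMap.ker d →
      ∀ x ∈ 𝒯 n s ⊓ LinearMap.ker d, x ∈ P ⊔ L n s → x ∈ P := by
    intro n s P hP x hx hxP
    obtain ⟨y, hy, l, hl, rfl⟩ := Submodule.mem_sup.1 hxP
    have : l = 0 := by
      refine Submodule.disjoint_def.1 (hZL n s) l ?_ hl
      simpa using Submodule.sub_mem _ hx (hP hy)
    rwa [this, add_zero]
  have hp : ∀ i : ℕ × ℕ, ∃ u : T →ₗ[k] T, (∀ x ∈ H i.1 i.2, u x = x) ∧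
      (∀ x ∈ L i.1 i.2, u x = 0) ∧ ∀ x ∈ 𝒯 i.1 i.2 ⊓ LinearMap.range d, u x = 0 := by
    rintro ⟨n, s⟩
    obtain ⟨h, h1, h2⟩ := exists_leftInverse_vanishing (H n s).subtype
      ((𝒯 n s ⊓ LinearMap.range d) ⊔ L n s) (by
        rintro ⟨x, hx⟩ hx'
        exact Subtype.ext (Submodule.disjoint_def.1 (hBH n s) x
          (hsplit n s _ (hBT n s) x (hHZ n s hx) hx') hx))
    refine ⟨(H n s).subtype ∘ₗ h, fun x hx => ?_, fun x hx => ?_, fun x hx => ?_⟩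
    · exact congrArg Subtype.val (h1 ⟨x, hx⟩)
    · exact congrArg Subtype.val (h2 x (Submodule.mem_sup_right hx))
    · exact congrArg Subtype.val (h2 x (Submodule.mem_sup_left hx))
  have hG : ∀ i : ℕ × ℕ, ∃ u : T →ₗ[k] T, (∀ x ∈ H i.1 i.2, u x = 0) ∧
      (∀ x ∈ L i.1 i.2, u x = 0) ∧ ∀ n, n + 1 = i.1 → ∀ x ∈ L n i.2, u (d x) = x := by
    rintro ⟨_ | n, s⟩
    · exact ⟨0, fun _ _ => rfl, fun _ _ => rfl, fun n hn => by simp at hn⟩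
    · obtain ⟨h, h1, h2⟩ := exists_leftInverse_vanishing (d ∘ₗ (L n s).subtype)
        (H (n + 1) s ⊔ L (n + 1) s) (by
          rintro ⟨x, hx⟩ hx'
          have hB : d x ∈ 𝒯 (n + 1) s ⊓ LinearMap.range d := ⟨hd n s x (hLT n s hx), x, rfl⟩
          have hH := hsplit (n + 1) s _ (hHZ (n + 1) s) (d x) (hBT _ _ hB) hx'
          have h0 := Submodule.disjoint_def.1 (hBH (n + 1) s) _ hB hH
          exact Subtype.ext (Submodule.disjoint_def.1 (hZL n s) x ⟨hLT n s hx, h0⟩ hx))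
      refine ⟨(L n s).subtype ∘ₗ h, fun x hx => ?_, fun x hx => ?_, fun m hm x hx => ?_⟩
      · exact congrArg Subtype.val (h2 x (Submodule.mem_sup_left hx))
      · exact congrArg Subtype.val (h2 x (Submodule.mem_sup_right hx))
      · obtain rfl : m = n := by simpa using hm
        exact congrArg Subtype.val (h1 ⟨x, hx⟩)
  choose up hup1 hup2 hup3 using hp
  choose uG huG1 huG2 huG3 using hG
  obtain ⟨p, hp⟩ := exists_linearMap_of_isInternal hint up
  obtain ⟨G, hG⟩ := exists_linearMap_of_isInternal hint uG
  refine ⟨{ H := H, L := L, disjoint_B_H := hBH, B_sup_H := hZ, disjoint_Z_L := hZL,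
            Z_sup_L := hT, p := p, p_H := ?_, p_L := ?_, p_B := ?_, G := G, G_H := ?_,
            G_L := ?_, G_B := ?_ }, rfl, rfl⟩
  · intro n s x hx
    rw [hp (n, s) x (hHZ n s hx).1, hup1 (n, s) x hx]
  · intro n s x hx
    rw [hp (n, s) x (hLT n s hx), hup2 (n, s) x hx]
  · intro x
    have h : (⊤ : Submodule k T) ≤ LinearMap.ker (p ∘ₗ d) := by
      rw [← hint.submodule_iSup_eq_top]
      refine iSup_le fun i x hx => ?_
      have := hd i.1 i.2 x hx
      change p (d x) = 0
      rw [hp (i.1 + 1, i.2) _ this, hup3 (i.1 + 1, i.2) _ ⟨this, x, rfl⟩]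
    exact h trivial
  · intro n s x hx
    rw [hG (n, s) x (hHZ n s hx).1, huG1 (n, s) x hx]
  · intro n s x hx
    rw [hG (n, s) x (hLT n s hx), huG2 (n, s) x hx]
  · intro n s x hx
    rw [hG (n + 1, s) _ (hd n s x (hLT n s hx)), huG3 (n + 1, s) n rfl x hx]

end Existence

/-! ### Existence of compatible decompositions -/

section CompatibleExistence

variable {k A : Type*} [Field k] [Ring A] [Algebra k A]
variable {𝒜 : ℕ → Submodule k A} [GradedAlgebra 𝒜] {g : Generators 𝒜} {e : g.Embedding}
variable {R : ℕ → Submodule k (g.tot ⊗[k] augIdeal 𝒜)}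

/-- Every `2`-cochain agrees on `ξ(D)` with a coboundary. -/
theorem exists_barDiff_eq_on_ξ (e : g.Embedding) {s : ℕ} {f : barDual 𝒜}
    (hf : f ∈ barPart 𝒜 2 s) :
    ∃ l ∈ barPart 𝒜 1 s, ∀ x : decomposables 𝒜,
      evalTwo (barDiff 𝒜 l) (g.QAIncl (e.ξ x)) = evalTwo f (g.QAIncl (e.ξ x)) := by
  obtain ⟨l, hl, hl'⟩ := exists_cochain_one s
    (-(evalTwo f ∘ₗ g.QAIncl ∘ₗ e.ξ ∘ₗ g.projDec)) (fun t ht a ha => by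
      have := evalTwo_QAIncl_eq_zero g ht hf (e.ξ_mem t _ (g.proj_mem_augPart ha).2)
      simp [this])
  refine ⟨l, hl, fun x => ?_⟩
  rw [evalTwo_barDiff_QAIncl, e.mul_ξ, hl', LinearMap.neg_apply, neg_neg]
  simp only [LinearMap.comp_apply, g.projDec_of_mem]

theorem barPart_inf_range_le (n s : ℕ) :
    barPart 𝒜 n s ⊓ LinearMap.range (barDiff 𝒜) ≤
      barPart 𝒜 n s ⊓ LinearMap.ker (barDiff 𝒜) := by
  rintro _ ⟨h, x, rfl⟩
  exact ⟨h, barDiff_barDiff x⟩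

/-- In cohomological degree `1`, the cocycles are the annihilator of `𝔪²`, and the annihilator of `Q`
is a complement. -/
theorem decomposition_one (g : Generators 𝒜) (s : ℕ) :
    ∃ L : Submodule k (barDual 𝒜),
      Disjoint (barPart 𝒜 1 s ⊓ LinearMap.ker (barDiff 𝒜)) L ∧
      (barPart 𝒜 1 s ⊓ LinearMap.ker (barDiff 𝒜)) ⊔ L = barPart 𝒜 1 s ∧
      ∀ f ∈ L, ∀ q : g.tot, evalOne f q = 0 := by
  let L : Submodule k (barDual 𝒜) :=
    { carrier := {f | f ∈ barPart 𝒜 1 s ∧ ∀ q : g.tot, evalOne f q = 0}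
      add_mem' := fun {x y} hx hy => ⟨Submodule.add_mem _ hx.1 hy.1, fun q => by
        rw [evalOne_add, LinearMap.add_apply, hx.2, hy.2, add_zero]⟩
      zero_mem' := ⟨Submodule.zero_mem _, fun q => rfl⟩
      smul_mem' := fun c x hx => ⟨Submodule.smul_mem _ c hx.1, fun q => by
        rw [evalOne_smul, LinearMap.smul_apply, hx.2, smul_zero]⟩ }
  refine ⟨L, ?_, ?_, fun f hf => hf.2⟩
  · rw [Submodule.disjoint_def]
    rintro f ⟨hf, hker⟩ ⟨-, hQ⟩
    refine barPart_one_ext hf (Submodule.zero_mem _) fun a => ?_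
    obtain ⟨q, x, rfl⟩ := g.exists_eq_add a
    rw [map_add, hQ, (barDiff_eq_zero_iff_one hf).1 hker x x.2, add_zero]
    rfl
  · refine le_antisymm (sup_le inf_le_left fun f hf => hf.1) fun f hf => ?_
    obtain ⟨z, hz, hz'⟩ := exists_cochain_one s (evalOne f ∘ₗ g.tot.subtype ∘ₗ g.projGen)
      fun t ht a ha => evalOne_eq_zero ht hf (g.proj_mem_augPart ha).1
    obtain ⟨l, hl, hl'⟩ := exists_cochain_one s
      (evalOne f ∘ₗ (decomposables 𝒜).subtype ∘ₗ g.projDec)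
      fun t ht a ha => evalOne_eq_zero ht hf (g.proj_mem_augPart ha).2
    refine Submodule.mem_sup.2 ⟨z, ⟨hz, ?_⟩, l, ⟨hl, fun q => ?_⟩, ?_⟩
    · refine (barDiff_eq_zero_iff_one hz).2 fun x hx => ?_
      rw [hz']
      simp [g.projGen_of_dec hx]
    · rw [hl']
      simp [g.projDec_of_gen q.2]
    · refine barPart_one_ext (Submodule.add_mem _ hz hl) hf fun a => ?_
      obtain ⟨q, x, rfl⟩ := g.exists_eq_add a
      rw [evalOne_add, LinearMap.add_apply, hz', hl']
      simp [g.projGen_of_mem, g.projDec_of_mem, g.projGen_of_dec x.2, g.projDec_of_gen q.2]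

/-- In cohomological degree `2`, one takes for `H` the cocycles that vanish on `ξ(D)`, and for `L` the
cochains that vanish on `ξ(D)` and `R`. -/
theorem decomposition_two [Nontrivial A] (hR : e.IsMinimalRelations R) (s : ℕ) :
    ∃ H L : Submodule k (barDual 𝒜),
      Disjoint (barPart 𝒜 2 s ⊓ LinearMap.range (barDiff 𝒜)) H ∧
      (barPart 𝒜 2 s ⊓ LinearMap.range (barDiff 𝒜)) ⊔ H =
        barPart 𝒜 2 s ⊓ LinearMap.ker (barDiff 𝒜) ∧
      Disjoint (barPart 𝒜 2 s ⊓ LinearMap.ker (barDiff 𝒜)) L ∧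
      (barPart 𝒜 2 s ⊓ LinearMap.ker (barDiff 𝒜)) ⊔ L = barPart 𝒜 2 s ∧
      (∀ f ∈ H, ∀ x : decomposables 𝒜, evalTwo f (g.QAIncl (e.ξ x)) = 0) ∧
      (∀ f ∈ L, ∀ x : decomposables 𝒜, evalTwo f (g.QAIncl (e.ξ x)) = 0) ∧
      ∀ f ∈ L, ∀ r ∈ R s, evalTwo f (g.QAIncl r) = 0 := by
  let X : Submodule k (barDual 𝒜) :=
    { carrier := {f | f ∈ barPart 𝒜 2 s ∧
        ∀ x : decomposables 𝒜, evalTwo f (g.QAIncl (e.ξ x)) = 0}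
      add_mem' := fun {x y} hx hy => ⟨Submodule.add_mem _ hx.1 hy.1, fun q => by
        rw [evalTwo_add, LinearMap.add_apply, hx.2, hy.2, add_zero]⟩
      zero_mem' := ⟨Submodule.zero_mem _, fun q => by rw [evalTwo_zero, LinearMap.zero_apply]⟩
      smul_mem' := fun c x hx => ⟨Submodule.smul_mem _ c hx.1, fun q => by
        rw [evalTwo_smul, LinearMap.smul_apply, hx.2, smul_zero]⟩ }
  let Y : Submodule k (barDual 𝒜) :=
    { carrier := {f | ∀ r ∈ R s, evalTwo f (g.QAIncl r) = 0}
      add_mem' := fun {x y} hx hy r hr => by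
        rw [evalTwo_add, LinearMap.add_apply, hx r hr, hy r hr, add_zero]
      zero_mem' := fun r _ => by rw [evalTwo_zero, LinearMap.zero_apply]
      smul_mem' := fun c x hx r hr => by
        rw [evalTwo_smul, LinearMap.smul_apply, hx r hr, smul_zero] }
  refine ⟨X ⊓ LinearMap.ker (barDiff 𝒜), X ⊓ Y, ?_, ?_, ?_, ?_, fun f hf => hf.1.2,
    fun f hf => hf.1.2, fun f hf => hf.2⟩
  · rw [Submodule.disjoint_def]
    rintro _ ⟨hf, l, rfl⟩ ⟨⟨-, hξ⟩, -⟩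
    refine barPart_two_ext hf (Submodule.zero_mem _) fun a b => ?_
    have h := hξ ⟨a * b, mul_mem_decomposables 𝒜 a b⟩
    rw [evalTwo_barDiff_QAIncl, e.mul_ξ] at h
    rw [evalTwo_barDiff_tmul, h, evalTwo_zero, LinearMap.zero_apply]
  · refine le_antisymm (sup_le (barPart_inf_range_le 2 s) fun f hf => ⟨hf.1.1, hf.2⟩) ?_
    rintro f ⟨hf, hker⟩
    obtain ⟨l, hl, hl'⟩ := exists_barDiff_eq_on_ξ e hf
    refine Submodule.mem_sup.2 ⟨barDiff 𝒜 l, ⟨barDiff_mem hl, l, rfl⟩, f + (-1 : k) • barDiff 𝒜 l,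
      ⟨⟨Submodule.add_mem _ hf (Submodule.smul_mem _ _ (barDiff_mem hl)), fun x => ?_⟩, ?_⟩, ?_⟩
    · rw [evalTwo_add, evalTwo_smul, LinearMap.add_apply, LinearMap.smul_apply, hl']
      simp
    · refine LinearMap.mem_ker.2 ?_
      rw [map_add, map_smul, barDiff_barDiff, LinearMap.mem_ker.1 hker]
      simp
    · simp
  · rw [Submodule.disjoint_def]
    rintro f ⟨hf, hker⟩ ⟨⟨-, hξ⟩, hY⟩
    refine barPart_two_ext hf (Submodule.zero_mem _) fun a b => ?_
    rw [evalTwo_zero, LinearMap.zero_apply]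
    refine hR.evalTwo_eq_zero ((barDiff_eq_zero_iff_two hf).1 hker) (fun t r hr => ?_) hξ a b
    rcases eq_or_ne t s with rfl | ht
    · exact hY r hr
    · exact evalTwo_QAIncl_eq_zero g ht hf (hR.le t hr)
  · refine le_antisymm (sup_le inf_le_left fun f hf => hf.1.1) fun f hf => ?_
    obtain ⟨l, hl, hl'⟩ := exists_barDiff_eq_on_ξ e hf
    obtain ⟨h, hh, hker, hhR, hhξ⟩ :=
      hR.exists_cocycle s (evalTwo f ∘ₗ g.QAIncl ∘ₗ (R s).subtype)
    refine Submodule.mem_sup.2 ⟨barDiff 𝒜 l + h, ⟨Submodule.add_mem _ (barDiff_mem hl) hh, ?_⟩,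
      f + (-1 : k) • (barDiff 𝒜 l + h), ⟨⟨Submodule.add_mem _ hf (Submodule.smul_mem _ _
        (Submodule.add_mem _ (barDiff_mem hl) hh)), fun x => ?_⟩, fun r hr => ?_⟩, ?_⟩
    · refine LinearMap.mem_ker.2 ?_
      rw [map_add, barDiff_barDiff, hker, add_zero]
    · rw [evalTwo_add, evalTwo_smul, evalTwo_add, LinearMap.add_apply, LinearMap.smul_apply,
        LinearMap.add_apply, hl', hhξ]
      simp
    · have h1 := hhR ⟨r, hr⟩
      simp only [LinearMap.comp_apply, Submodule.subtype_apply] at h1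
      rw [evalTwo_add, evalTwo_smul, evalTwo_add, LinearMap.add_apply, LinearMap.smul_apply,
        LinearMap.add_apply, h1, evalTwo_barDiff_QAIncl, hR.QAMul_eq_zero hr]
      simp
    · rw [neg_one_smul]
      abel

theorem exists_isCompatible [Nontrivial A] (hR : e.IsMinimalRelations R) :
    ∃ M : ExtModel 𝒜, M.IsCompatible e R := by
  have h : ∀ n s, ∃ H L : Submodule k (barDual 𝒜),
      Disjoint (barPart 𝒜 n s ⊓ LinearMap.range (barDiff 𝒜)) H ∧
      (barPart 𝒜 n s ⊓ LinearMap.range (barDiff 𝒜)) ⊔ H =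
        barPart 𝒜 n s ⊓ LinearMap.ker (barDiff 𝒜) ∧
      Disjoint (barPart 𝒜 n s ⊓ LinearMap.ker (barDiff 𝒜)) L ∧
      (barPart 𝒜 n s ⊓ LinearMap.ker (barDiff 𝒜)) ⊔ L = barPart 𝒜 n s ∧
      (n = 1 → ∀ f ∈ L, ∀ q : g.tot, evalOne f q = 0) ∧
      (n = 2 → (∀ f ∈ H, ∀ x : decomposables 𝒜, evalTwo f (g.QAIncl (e.ξ x)) = 0) ∧
        (∀ f ∈ L, ∀ x : decomposables 𝒜, evalTwo f (g.QAIncl (e.ξ x)) = 0) ∧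
        ∀ f ∈ L, ∀ r ∈ R s, evalTwo f (g.QAIncl r) = 0) := by
    intro n s
    by_cases h2 : n = 2
    · subst h2
      obtain ⟨H, L, h1, h2, h3, h4, h5⟩ := decomposition_two hR s
      exact ⟨H, L, h1, h2, h3, h4, by simp, fun _ => h5⟩
    · obtain ⟨H, hH1, hH2⟩ := exists_relative_compl (barPart_inf_range_le (𝒜 := 𝒜) n s)
      by_cases h1 : n = 1
      · subst h1
        obtain ⟨L, hL1, hL2, hL3⟩ := decomposition_one g s
        exact ⟨H, L, hH1, hH2, hL1, hL2, fun _ => hL3, by simp⟩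
      · obtain ⟨L, hL1, hL2⟩ := exists_relative_compl
          (inf_le_left : barPart 𝒜 n s ⊓ LinearMap.ker (barDiff 𝒜) ≤ _)
        exact ⟨H, L, hH1, hH2, hL1, hL2, fun h => absurd h h1, fun h => absurd h h2⟩
  choose H L h1 h2 h3 h4 h5 h6 using h
  obtain ⟨M, hMH, hML⟩ : ∃ M : ExtModel 𝒜, M.H = H ∧ M.L = L :=
    exists_merkulovData (T := barDual 𝒜) (𝒯 := barPart 𝒜) (d := barDiff 𝒜) isInternal_barPart
      (fun n s x hx => barDiff_mem hx) H L h1 h2 h3 h4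
  refine ⟨M, ⟨?_, ?_, ?_, ?_⟩⟩
  · rw [hML]; exact fun s => h5 1 s rfl
  · rw [hMH]; exact fun s => (h6 2 s rfl).1
  · rw [hML]; exact fun s => (h6 2 s rfl).2.1
  · rw [hML]; exact fun s => (h6 2 s rfl).2.2

end CompatibleExistence

/-! ### The homotopy and the higher products in low degrees -/

section Products

variable {k A : Type*} [Field k] [Ring A] [Algebra k A]
variable {𝒜 : ℕ → Submodule k A} [GradedAlgebra 𝒜] {g : Generators 𝒜} {e : g.Embedding}
variable {R : ℕ → Submodule k (g.tot ⊗[k] augIdeal 𝒜)} {M : ExtModel 𝒜}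

theorem ExtModel.L_le (M : ExtModel 𝒜) (n s : ℕ) : M.L n s ≤ barPart 𝒜 n s :=
  le_of_le_of_eq le_sup_right (M.Z_sup_L n s)

theorem ExtModel.H_le (M : ExtModel 𝒜) (n s : ℕ) :
    M.H n s ≤ barPart 𝒜 n s ⊓ LinearMap.ker (barDiff 𝒜) :=
  le_of_le_of_eq le_sup_right (M.B_sup_H n s)

/-- There are no nonzero coboundaries in degree `1`, so `H` consists of all cocycles. -/
theorem ExtModel.mem_H_one {s : ℕ} {f : barDual 𝒜} :
    f ∈ M.H 1 s ↔ f ∈ barPart 𝒜 1 s ∧ barDiff 𝒜 f = 0 := by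
  refine ⟨fun h => M.H_le 1 s h, fun h => ?_⟩
  have hf : f ∈ barPart 𝒜 1 s ⊓ LinearMap.ker (barDiff 𝒜) := h
  rw [← M.B_sup_H 1 s] at hf
  obtain ⟨_, ⟨hb, y, rfl⟩, x, hx, rfl⟩ := Submodule.mem_sup.1 hf
  have h0 : barDiff 𝒜 y = 0 :=
    barPart_one_ext hb (Submodule.zero_mem _) fun a => evalOne_barDiff y a
  rwa [h0, zero_add]

/-- A coboundary in bidegree `(2, -s)` is the coboundary of a cochain in bidegree `(1, -s)`. -/
theorem exists_homogeneous_primitive {s : ℕ} {y : barDual 𝒜}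
    (hy : barDiff 𝒜 y ∈ barPart 𝒜 2 s) :
    ∃ l ∈ barPart 𝒜 1 s, barDiff 𝒜 l = barDiff 𝒜 y := by
  obtain ⟨l, hl, hl'⟩ := exists_cochain_one s (evalOne y ∘ₗ augProj 𝒜 s) fun t ht a ha => by
    rw [LinearMap.comp_apply, augProj_of_mem_ne 𝒜 ha ht, map_zero]
  refine ⟨l, hl, barPart_two_ext (s := s) (barDiff_mem hl) hy fun a b => ?_⟩
  let S (b : augIdeal 𝒜) : Submodule k (augIdeal 𝒜) := LinearMap.eqLocus
    (evalTwo (barDiff 𝒜 l) ∘ₗ (TensorProduct.mk k (augIdeal 𝒜) (augIdeal 𝒜)).flip b)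
    (evalTwo (barDiff 𝒜 y) ∘ₗ (TensorProduct.mk k (augIdeal 𝒜) (augIdeal 𝒜)).flip b)
  refine augIdeal_le_of_augPart_le 𝒜 (S := S b) (fun i a ha => ?_) a
  let S' : Submodule k (augIdeal 𝒜) := LinearMap.eqLocus
    (evalTwo (barDiff 𝒜 l) ∘ₗ TensorProduct.mk k (augIdeal 𝒜) (augIdeal 𝒜) a)
    (evalTwo (barDiff 𝒜 y) ∘ₗ TensorProduct.mk k (augIdeal 𝒜) (augIdeal 𝒜) a)
  refine augIdeal_le_of_augPart_le 𝒜 (S := S') (fun j b hb => ?_) b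
  change evalTwo (barDiff 𝒜 l) (a ⊗ₜ[k] b) = evalTwo (barDiff 𝒜 y) (a ⊗ₜ[k] b)
  by_cases h : i + j = s
  · subst h
    rw [evalTwo_barDiff_tmul, evalTwo_barDiff_tmul, hl', LinearMap.comp_apply,
      augProj_of_mem 𝒜 (mul_mem_augPart 𝒜 ha hb)]
  · rw [evalTwo_eq_zero h hy ha hb, evalTwo_eq_zero h (barDiff_mem hl) ha hb]

theorem ExtModel.exists_decomposition_two (M : ExtModel 𝒜) {s : ℕ} {y : barDual 𝒜}
    (hy : y ∈ barPart 𝒜 2 s) :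
    ∃ l ∈ M.L 1 s, ∃ h ∈ M.H 2 s, ∃ l' ∈ M.L 2 s, y = barDiff 𝒜 l + h + l' := by
  rw [← M.Z_sup_L 2 s] at hy
  obtain ⟨z, hz, l', hl', rfl⟩ := Submodule.mem_sup.1 hy
  rw [← M.B_sup_H 2 s] at hz
  obtain ⟨_, ⟨hb, t, rfl⟩, h, hh, rfl⟩ := Submodule.mem_sup.1 hz
  obtain ⟨t', ht', htt'⟩ := exists_homogeneous_primitive hb
  rw [← M.Z_sup_L 1 s] at ht'
  obtain ⟨c, hc, l, hl, rfl⟩ := Submodule.mem_sup.1 ht'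
  refine ⟨l, hl, h, hh, l', hl', ?_⟩
  rw [← htt', map_add, show barDiff 𝒜 c = 0 from hc.2, zero_add]

/-- On cochains of degree `2`, the homotopy `G` is minus the transpose of
`𝔪 = Q ⊕ 𝔪² → 𝔪² → Q ⊗ 𝔪`, the second map being `ξ`. -/
theorem ExtModel.IsCompatible.G_two (hM : M.IsCompatible e R) {s : ℕ} {y : barDual 𝒜}
    (hy : y ∈ barPart 𝒜 2 s) :
    M.G y ∈ barPart 𝒜 1 s ∧ (∀ q : g.tot, evalOne (M.G y) q = 0) ∧
      ∀ x : decomposables 𝒜, evalOne (M.G y) x = - evalTwo y (g.QAIncl (e.ξ x)) := by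
  obtain ⟨l, hl, h, hh, l', hl', rfl⟩ := M.exists_decomposition_two hy
  have hG : M.G (barDiff 𝒜 l + h + l') = l := by
    rw [map_add, map_add, M.G_B 1 s l hl, M.G_H 2 s h hh, M.G_L 2 s l' hl', add_zero, add_zero]
  rw [hG]
  refine ⟨M.L_le 1 s hl, hM.L_one s l hl, fun x => ?_⟩
  rw [evalTwo_add, evalTwo_add, LinearMap.add_apply, LinearMap.add_apply, hM.H_two s h hh,
    hM.L_two s l' hl', evalTwo_barDiff_QAIncl, e.mul_ξ, add_zero, add_zero, neg_neg]

/-- On cochains of degree `2`, the projection `p` does not change the restriction to `R`. -/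
theorem ExtModel.IsCompatible.p_two (hM : M.IsCompatible e R) (hR : e.IsMinimalRelations R)
    {s : ℕ} {y : barDual 𝒜} (hy : y ∈ barPart 𝒜 2 s) :
    M.p y ∈ M.H 2 s ∧
      ∀ r ∈ R s, evalTwo (M.p y) (g.QAIncl r) = evalTwo y (g.QAIncl r) := by
  obtain ⟨l, hl, h, hh, l', hl', rfl⟩ := M.exists_decomposition_two hy
  have hp : M.p (barDiff 𝒜 l + h + l') = h := by
    rw [map_add, map_add, M.p_B l, M.p_H 2 s h hh, M.p_L 2 s l' hl', zero_add, add_zero]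
  rw [hp]
  refine ⟨hh, fun r hr => ?_⟩
  rw [evalTwo_add, evalTwo_add, LinearMap.add_apply, LinearMap.add_apply,
    hM.L_two_R s l' hl' r hr, evalTwo_barDiff_QAIncl, hR.QAMul_eq_zero hr, map_zero, neg_zero,
    zero_add, add_zero]

/-- `E^1_{-s}` is the dual of `Q_s`. -/
theorem ExtModel.existsUnique_H_one (M : ExtModel 𝒜) (g : Generators 𝒜) (s : ℕ)
    (φ : Module.Dual k (g.Q s)) :
    ∃! f : barDual 𝒜, f ∈ M.H 1 s ∧ ∀ q : g.Q s, evalOne f q = φ q := by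
  obtain ⟨ψ, hψ⟩ := exists_dual_extension (g.Q s) φ
  obtain ⟨f, hf, hf'⟩ := exists_cochain_one s (ψ ∘ₗ augProj 𝒜 s ∘ₗ g.tot.subtype ∘ₗ g.projGen)
    fun t ht a ha => by
      have := augProj_of_mem_ne 𝒜 (g.proj_mem_augPart ha).1 ht
      simp [this]
  have hfQ : ∀ q : g.Q s, evalOne f q = φ q := fun q => by
    have h := g.projGen_of_mem ⟨q, g.Q_le_tot s q.2⟩
    rw [hf', LinearMap.comp_apply, LinearMap.comp_apply, LinearMap.comp_apply, h,
      Submodule.subtype_apply, augProj_of_mem 𝒜 (g.Q_le_augPart s q.2), hψ]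
  have hfc : barDiff 𝒜 f = 0 := by
    rw [barDiff_eq_zero_iff_one hf]
    intro x hx
    rw [hf']
    simp [g.projGen_of_dec hx]
  refine ⟨f, ⟨M.mem_H_one.2 ⟨hf, hfc⟩, hfQ⟩, ?_⟩
  rintro f' ⟨hf'H, hf'Q⟩
  obtain ⟨hf'1, hf'c⟩ := M.mem_H_one.1 hf'H
  rw [barDiff_eq_zero_iff_one hf] at hfc
  rw [barDiff_eq_zero_iff_one hf'1] at hf'c
  refine barPart_one_ext hf'1 hf fun a => ?_
  refine augIdeal_le_of_augPart_le 𝒜 (S := LinearMap.eqLocus (evalOne f') (evalOne f))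
    (fun t a ha => ?_) a
  rw [LinearMap.mem_eqLocus]
  rcases eq_or_ne t s with rfl | ht
  · rw [← g.Q_sup_D t] at ha
    obtain ⟨q, hq, x, hx, rfl⟩ := Submodule.mem_sup.1 ha
    rw [map_add, map_add, hfc x hx.1, hf'c x hx.1, hf'Q ⟨q, hq⟩, hfQ ⟨q, hq⟩]
  · rw [evalOne_eq_zero ht hf ha, evalOne_eq_zero ht hf'1 ha]

/-- `E^2_{-s}` is the dual of `R_s`. -/
theorem ExtModel.IsCompatible.existsUnique_H_two [Nontrivial A] (hM : M.IsCompatible e R)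
    (hR : e.IsMinimalRelations R) (s : ℕ) (φ : Module.Dual k (R s)) :
    ∃! f : barDual 𝒜, f ∈ M.H 2 s ∧ ∀ r : R s, evalTwo f (g.QAIncl r) = φ r := by
  obtain ⟨f, hf, -, hfR, -⟩ := hR.exists_cocycle s φ
  obtain ⟨hp, hpR⟩ := hM.p_two hR hf
  refine ⟨M.p f, ⟨hp, fun r => by rw [hpR r r.2, hfR]⟩, ?_⟩
  rintro f' ⟨hf', hf'R⟩
  have hd : f' + (-1 : k) • M.p f ∈ M.H 2 s := Submodule.add_mem _ hf' (Submodule.smul_mem _ _ hp)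
  obtain ⟨hd2, hdc⟩ := M.H_le 2 s hd
  have h0 : f' + (-1 : k) • M.p f = 0 := by
    refine barPart_two_ext hd2 (Submodule.zero_mem _) fun a b => ?_
    rw [evalTwo_zero, LinearMap.zero_apply]
    refine hR.evalTwo_eq_zero ((barDiff_eq_zero_iff_two hd2).1 hdc) (fun t r hr => ?_)
      (hM.H_two s _ hd) a b
    rcases eq_or_ne t s with rfl | ht
    · rw [evalTwo_add, evalTwo_smul, LinearMap.add_apply, LinearMap.smul_apply, hf'R ⟨r, hr⟩,
        hpR r hr, hfR ⟨r, hr⟩]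
      simp
    · exact evalTwo_QAIncl_eq_zero g ht hd2 (hR.le t hr)
  rwa [neg_one_smul, ← sub_eq_add_neg, sub_eq_zero] at h0

theorem evalTwo_mul {s t : ℕ} {f h : barDual 𝒜} (hf : f ∈ barPart 𝒜 1 s)
    (hh : h ∈ barPart 𝒜 1 t) (a b : augIdeal 𝒜) :
    evalTwo (f * h) (a ⊗ₜ[k] b) = -(evalOne f a * evalOne h b) := by
  rw [evalTwo_tmul]
  change ((f : WordFun k (augIdeal 𝒜)) * (h : WordFun k (augIdeal 𝒜))) [a, b] = _
  have h1 : (f : WordFun k (augIdeal 𝒜)) [] = 0 := barPart_apply_eq_zero hf (by simp)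
  have h2 : (h : WordFun k (augIdeal 𝒜)) [] = 0 := barPart_apply_eq_zero hh (by simp)
  rw [WordFun.mul_apply]
  simp [Finset.sum_range_succ, h1, h2, evalOne_apply]

theorem barTwist_mem (c : ℕ) {n s : ℕ} {f : barDual 𝒜} (hf : f ∈ barPart 𝒜 n s) :
    barTwist 𝒜 c f ∈ barPart 𝒜 n s := wordTwist_mem 𝒜 c hf

theorem evalOne_barTwist (c : ℕ) (f : barDual 𝒜) (a : augIdeal 𝒜) :
    evalOne (barTwist 𝒜 c f) a = (-1 : k) ^ c * evalOne f a := by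
  change wordTwist c (f : WordFun k (augIdeal 𝒜)) [a] = _
  rw [wordTwist_apply]
  simp [evalOne_apply]

theorem neg_one_pow_mul_eq_smul {T : Type*} [Ring T] [Algebra k T] (n : ℕ) (x : T) :
    (-1 : T) ^ n * x = (-1 : k) ^ n • x := by
  rw [Algebra.smul_def, map_pow, map_neg, map_one]

/-- `w = [x₁, …, xₙ]` with `xᵢ` in bidegree `(1, -dᵢ)`. -/
abbrev IsOneWord (w : List (barDual 𝒜)) (ds : List ℕ) : Prop :=
  List.Forall₂ (fun x d => x ∈ barPart 𝒜 1 d) w ds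

theorem IsOneWord.map_barTwist {w : List (barDual 𝒜)} {ds : List ℕ} (h : IsOneWord w ds) (c : ℕ) :
    IsOneWord (w.map (barTwist 𝒜 c)) ds := by
  induction h with
  | nil => exact .nil
  | cons h _ ih => exact .cons (barTwist_mem c h) ih

theorem ExtModel.IsCompatible.lam_mem_and_Glam_mem (hM : M.IsCompatible e R)
    (w : List (barDual 𝒜)) (ds : List ℕ) (hw : IsOneWord w ds) :
    (2 ≤ w.length → lam (barTwist 𝒜) M.G w ∈ barPart 𝒜 2 ds.sum) ∧
    (w ≠ [] → Glam (barTwist 𝒜) M.G w ∈ barPart 𝒜 1 ds.sum) := by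
  induction hn : w.length using Nat.strong_induction_on generalizing w ds with
  | _ n ih =>
    have hlam : lam (barTwist 𝒜) M.G w ∈ barPart 𝒜 2 ds.sum := by
      rw [lam]
      refine Submodule.sum_mem _ fun q hq => ?_
      rw [Finset.mem_Ico] at hq
      rw [neg_one_pow_mul_eq_smul (k := k)]
      refine Submodule.smul_mem _ _ ?_
      have h1 := (ih q (by omega) ((w.take q).map (barTwist 𝒜 (w.length - q - 1))) (ds.take q)
        (IsOneWord.map_barTwist (List.forall₂_take q hw) _) (by simp; omega)).2 (by
          intro h
          have := congrArg List.length h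
          simp at this
          rcases this with h | h
          · omega
          · subst h; simp at hq)
      have h2 := (ih (w.length - q) (by omega) (w.drop q) (ds.drop q)
        (List.forall₂_drop q hw) (by simp)).2 (by
          intro h
          have := congrArg List.length h
          simp at this
          omega)
      have h3 := mul_mem_wordPart 𝒜 h1 h2
      rwa [List.sum_take_add_sum_drop] at h3
    refine ⟨fun _ => hlam, fun hne => ?_⟩
    match w, ds, hw with
    | [a], [d], .cons ha _ =>
      rw [Glam, List.sum_singleton]
      exact Submodule.neg_mem _ ha
    | a :: b :: w, ds, hw =>
      rw [Glam_eq _ _ _ (by simp)]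
      exact (hM.G_two hlam).1

theorem ExtModel.IsCompatible.evalOne_Glam_gen (hM : M.IsCompatible e R)
    {w : List (barDual 𝒜)} {ds : List ℕ} (hw : IsOneWord w ds) (h2 : 2 ≤ w.length) (q : g.tot) :
    evalOne (Glam (barTwist 𝒜) M.G w) q = 0 := by
  rw [Glam_eq _ _ _ h2]
  exact (hM.G_two ((hM.lam_mem_and_Glam_mem w ds hw).1 h2)).2.1 q

/-- The functional `f ↦ f(z)` on cochains. -/
def evalTwoAt (z : augIdeal 𝒜 ⊗[k] augIdeal 𝒜) : barDual 𝒜 →ₗ[k] k where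
  toFun f := evalTwo f z
  map_add' f h := by rw [evalTwo_add]; rfl
  map_smul' c f := by rw [evalTwo_smul]; rfl

theorem evalTwoAt_apply (z : augIdeal 𝒜 ⊗[k] augIdeal 𝒜) (f : barDual 𝒜) :
    evalTwoAt z f = evalTwo f z := rfl

/-- On `Q ⊗ 𝔪` only the summand `q = 1` of `λₙ` contributes, since `Gλ_q` vanishes on `Q` for
`q ≥ 2`. -/
theorem ExtModel.IsCompatible.evalTwo_lam_cons (hM : M.IsCompatible e R) {x : barDual 𝒜}
    {w : List (barDual 𝒜)} {ds : List ℕ} (hxw : IsOneWord (x :: w) ds) (hne : w ≠ [])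
    (q : g.tot) (b : augIdeal 𝒜) :
    evalTwo (lam (barTwist 𝒜) M.G (x :: w)) ((q : augIdeal 𝒜) ⊗ₜ[k] b) =
      (-1 : k) ^ (w.length + 1) * (evalOne x q * evalOne (Glam (barTwist 𝒜) M.G w) b) := by
  have hlen : 1 ≤ w.length := List.length_pos_iff.2 hne
  rw [← evalTwoAt_apply, lam, map_sum, Finset.sum_eq_single 1]
  · match ds, hxw with
    | d :: ds, .cons hx hw =>
      rw [neg_one_pow_mul_eq_smul (k := k), map_smul, evalTwoAt_apply]
      simp only [List.take_succ_cons, List.take_zero, List.drop_succ_cons, List.drop_zero,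
        List.map_cons, List.map_nil, List.length_cons, Nat.add_sub_cancel]
      rw [Glam, evalTwo_mul (Submodule.neg_mem _ (barTwist_mem _ hx))
        ((hM.lam_mem_and_Glam_mem w ds hw).2 hne), ← neg_one_smul k (barTwist 𝒜 _ x), evalOne_smul,
        LinearMap.smul_apply, evalOne_barTwist]
      obtain ⟨m, hm⟩ : ∃ m, w.length = m + 1 := ⟨w.length - 1, by omega⟩
      rw [hm, Nat.add_sub_cancel]
      simp only [smul_eq_mul]
      ring
  · intro j hj hj1
    rw [Finset.mem_Ico, List.length_cons] at hj
    rw [neg_one_pow_mul_eq_smul (k := k), map_smul, evalTwoAt_apply]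
    have hA : IsOneWord (((x :: w).take j).map (barTwist 𝒜 ((x :: w).length - j - 1)))
        (ds.take j) := IsOneWord.map_barTwist (List.forall₂_take j hxw) _
    have hlA : 2 ≤ (((x :: w).take j).map (barTwist 𝒜 ((x :: w).length - j - 1))).length := by
      simp
      omega
    rw [evalTwo_mul ((hM.lam_mem_and_Glam_mem _ _ hA).2 (by
        intro h
        rw [h] at hlA
        simp at hlA))
      ((hM.lam_mem_and_Glam_mem _ _ (List.forall₂_drop j hxw)).2 (by
        intro h
        have := congrArg List.length h
        simp at this
        omega)), hM.evalOne_Glam_gen hA hlA]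
    simp
  · intro h
    rw [Finset.mem_Ico, List.length_cons] at h
    omega

theorem isOneWord_ofFn {n : ℕ} {x : Fin n → barDual 𝒜} {d : Fin n → ℕ}
    (hx : ∀ i, x i ∈ barPart 𝒜 1 (d i)) : IsOneWord (List.ofFn x) (List.ofFn d) := by
  induction n with
  | zero => simp
  | succ n ih =>
    rw [List.ofFn_succ, List.ofFn_succ]
    exact .cons (hx 0) (ih fun i => hx i.succ)

theorem Generators.Embedding.tensorFunctional_zero_incl (e : g.Embedding)
    (φ : Fin 0 → Module.Dual k g.tot) (z : g.tot ⊗[k] augIdeal 𝒜) :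
    tensorFunctional φ (e.incl z) = 0 := by
  induction z using TensorProduct.induction_on with
  | zero => simp
  | tmul q a => rw [e.incl_tmul, tensorFunctional_zero_ι_mul]
  | add x y hx hy => rw [map_add, map_add, hx, hy, add_zero]

theorem Generators.Embedding.tensorFunctional_zero_θ (e : g.Embedding)
    (φ : Fin 0 → Module.Dual k g.tot) (a : augIdeal 𝒜) : tensorFunctional φ (e.θ a) = 0 := by
  obtain ⟨q, x, rfl⟩ := g.exists_eq_add a
  rw [map_add, e.θ_gen, ← e.incl_ξ, map_add, e.tensorFunctional_zero_incl, add_zero,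
    ← mul_one (TensorAlgebra.ι k q), tensorFunctional_zero_ι_mul]

theorem Generators.Embedding.tensorFunctional_one_incl (e : g.Embedding)
    (φ : Fin 1 → Module.Dual k g.tot) (z : g.tot ⊗[k] augIdeal 𝒜) :
    tensorFunctional φ (e.incl z) = 0 := by
  induction z using TensorProduct.induction_on with
  | zero => simp
  | tmul q a => rw [e.incl_tmul, tensorFunctional_ι_mul, e.tensorFunctional_zero_θ, mul_zero]
  | add x y hx hy => rw [map_add, map_add, hx, hy, add_zero]

/-- The sign `(-1)^{n(n-1)/2}`. -/
abbrev koszulSign (k : Type*) [Field k] (n : ℕ) : k := (-1) ^ (n * (n - 1) / 2)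

theorem koszulSign_succ (n : ℕ) : koszulSign k (n + 1) = koszulSign k n * (-1) ^ n := by
  rw [koszulSign, koszulSign, Nat.triangle_succ, pow_add]

/-- If `Gλₙ` is `-(-1)^{n(n-1)/2} (x₁ ⊗ ⋯ ⊗ xₙ) ∘ θ` for `n` arguments, then `λₙ₊₁` on `Q ⊗ 𝔪` is the
functional `(-1)^{(n+1)n/2} (x₀ ⊗ ⋯ ⊗ xₙ)` on `T(Q)`. -/
theorem ExtModel.IsCompatible.evalTwo_lam_of_evalOne_Glam (hM : M.IsCompatible e R) {n : ℕ}
    {x : Fin (n + 2) → barDual 𝒜} {d : Fin (n + 2) → ℕ} (hx : ∀ i, x i ∈ barPart 𝒜 1 (d i))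
    (ih : ∀ a, evalOne (Glam (barTwist 𝒜) M.G (List.ofFn fun i : Fin (n + 1) => x i.succ)) a =
      -(koszulSign k (n + 1) *
        tensorFunctional (fun i : Fin (n + 1) => evalOne (x i.succ) ∘ₗ g.tot.subtype) (e.θ a)))
    (z : g.tot ⊗[k] augIdeal 𝒜) :
    evalTwo (lam (barTwist 𝒜) M.G (List.ofFn x)) (g.QAIncl z) =
      koszulSign k (n + 2) *
        tensorFunctional (fun i => evalOne (x i) ∘ₗ g.tot.subtype) (e.incl z) := by
  induction z using TensorProduct.induction_on with
  | zero => simp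
  | tmul q b =>
    have hw := isOneWord_ofFn hx
    rw [List.ofFn_succ] at hw ⊢
    rw [g.QAIncl_tmul, hM.evalTwo_lam_cons hw (by simp), ih, e.incl_tmul,
      tensorFunctional_ι_mul, koszulSign_succ (n + 1), List.length_ofFn]
    simp only [LinearMap.comp_apply, Submodule.subtype_apply]
    ring
  | add x y hx hy => simp only [map_add, hx, hy, mul_add]

/-- `Gλₙ(x₁, …, xₙ) = -(-1)^{n(n-1)/2} (x₁ ⊗ ⋯ ⊗ xₙ) ∘ θ` for classes `xᵢ` of degree `1`. -/
theorem ExtModel.IsCompatible.evalOne_Glam (hM : M.IsCompatible e R) (n : ℕ)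
    (x : Fin (n + 1) → barDual 𝒜) (d : Fin (n + 1) → ℕ) (hx : ∀ i, x i ∈ M.H 1 (d i))
    (a : augIdeal 𝒜) :
    evalOne (Glam (barTwist 𝒜) M.G (List.ofFn x)) a =
      -(koszulSign k (n + 1) *
        tensorFunctional (fun i => evalOne (x i) ∘ₗ g.tot.subtype) (e.θ a)) := by
  induction n generalizing a with
  | zero =>
    obtain ⟨q, y, rfl⟩ := g.exists_eq_add a
    obtain ⟨h1, hc⟩ := M.mem_H_one.1 (hx 0)
    have hy := (barDiff_eq_zero_iff_one h1).1 hc y y.2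
    simp only [List.ofFn_succ, List.ofFn_zero]
    rw [Glam, ← neg_one_smul k (x 0), evalOne_smul, LinearMap.smul_apply, map_add, hy, map_add,
      e.θ_gen, ← e.incl_ξ, map_add, e.tensorFunctional_one_incl, tensorFunctional_ι]
    simp
  | succ n ih =>
    have hx1 : ∀ i, x i ∈ barPart 𝒜 1 (d i) := fun i => (M.mem_H_one.1 (hx i)).1
    have hw := isOneWord_ofFn hx1
    have h2 : 2 ≤ (List.ofFn x).length := by simp
    obtain ⟨q, y, rfl⟩ := g.exists_eq_add a
    have hlam := (hM.lam_mem_and_Glam_mem _ _ hw).1 h2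
    rw [map_add, hM.evalOne_Glam_gen hw h2, Glam_eq _ _ _ h2, (hM.G_two hlam).2.2 y,
      hM.evalTwo_lam_of_evalOne_Glam hx1 (ih _ (fun i => d i.succ) fun i => hx i.succ),
      e.incl_ξ, map_add, e.θ_gen, map_add, tensorFunctional_ι]
    simp

theorem Generators.Embedding.koszulPairing_inclProj (e : g.Embedding) {n : ℕ}
    (φ : Fin n → Module.Dual k g.tot) (z : g.tot ⊗[k] augIdeal 𝒜) :
    koszulPairing (V := g.tot) φ (e.inclProj n z) =
      koszulSign k n * tensorFunctional φ (e.incl z) := rfl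

end Products

end ExtAInf

end

open ExtAInf in
theorem theoremA {k A : Type*} [Field k] [Ring A] [Nontrivial A] [Algebra k A]
    (𝒜 : ℕ → Submodule k A) [GradedAlgebra 𝒜]
    (hconn : 𝒜 0 = 1) (hfin : ∀ s, Module.Finite k (𝒜 s))
    (g : Generators 𝒜) (e : g.Embedding)
    (R : ℕ → Submodule k (g.tot ⊗[k] augIdeal 𝒜)) (hR : e.IsMinimalRelations R) :
    (∃ M : ExtModel 𝒜, M.IsCompatible e R) ∧
    ∀ M : ExtModel 𝒜, M.IsCompatible e R →
      -- restriction of functionals identifies `E^1_{-s}` with the dual of `Q_s`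
      (∀ (s : ℕ) (φ : Module.Dual k (g.Q s)),
        ∃! f : barDual 𝒜, f ∈ M.H 1 s ∧ ∀ q : g.Q s, evalOne f q = φ q) ∧
      -- restriction of functionals identifies `E^2_{-s}` with the dual of `R_s`
      (∀ (s : ℕ) (φ : Module.Dual k (R s)),
        ∃! f : barDual 𝒜, f ∈ M.H 2 s ∧ ∀ r : R s, evalTwo f (g.QAIncl r) = φ r) ∧
      -- under these identifications `mₙ` on `((E^1)^{⊗ n})_{-s}` is the dual of `i_s^n`
      (∀ (n : ℕ), 2 ≤ n → ∀ (s : ℕ) (d : Fin n → ℕ), ∑ i, d i = s →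
        ∀ x : Fin n → barDual 𝒜, (∀ i, x i ∈ M.H 1 (d i)) →
          M.mul x ∈ M.H 2 s ∧
          ∀ r ∈ R s, evalTwo (M.mul x) (g.QAIncl r) =
            koszulPairing (V := g.tot) (fun i => evalOne (x i) ∘ₗ g.tot.subtype) (e.inclProj n r)) := by
  refine ⟨exists_isCompatible hR, fun M hM => ⟨M.existsUnique_H_one g,
    hM.existsUnique_H_two hR, fun n hn s d hd x hx => ?_⟩⟩
  obtain ⟨n, rfl⟩ : ∃ m, n = m + 2 := ⟨n - 2, by omega⟩
  have hx1 : ∀ i, x i ∈ barPart 𝒜 1 (d i) := fun i => (M.mem_H_one.1 (hx i)).1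
  have hlam : lam (barTwist 𝒜) M.G (List.ofFn x) ∈ barPart 𝒜 2 s := by
    rw [← hd, ← List.sum_ofFn]
    exact (hM.lam_mem_and_Glam_mem _ _ (isOneWord_ofFn hx1)).1 (by simp)
  obtain ⟨hp, hpR⟩ := hM.p_two hR hlam
  refine ⟨hp, fun r hr => ?_⟩
  rw [e.koszulPairing_inclProj, ExtModel.mul, hpR r hr]
  exact hM.evalTwo_lam_of_evalOne_Glam hx1
    (hM.evalOne_Glam n _ (fun i => d i.succ) fun i => hx i.succ) r
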